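/- Let $\Theta=(\theta_m)_{m\ge 1}$ be a sequence of non-negative real numbers. For a permutation $\sigma\in S_n$ let $\lambda=(\lambda_1,\dots,\lambda_\ell)$ be its cycle type (fixed points being cycles of length $1$), let $C_m(\sigma)$ be its number of cycles of length $m$, and put $$h_n=\frac1{n!}\sum_{\sigma\in S_n}\prod_{i=1}^{\ell}\theta_{\lambda_i},\qquad \mathbb{P}_\Theta[\sigma]=\frac{1}{h_n\,n!}\prod_{i=1}^{\ell}\theta_{\lambda_i}\quad(\text{when } h_n>0).$$ For $r,\vartheta>0$ and $K\in\mathbb{R}$ let $\mathcal{F}(r,\vartheta,K)$ be the set of functions $g$ for which there are $R>r$ and $0<\phi<\pi/2$ such that $g$ is holomorphic in $\Delta_0=\{z\in\mathbb{C}: |z|<R,\ z\ne r,\ |\arg(z-r)|>\phi\}$ and $$g(t)=\vartheta\log\Big(\frac1{1-t/r}\Big)+K+O(t-r)\qquad\text{as } t\to r,\ t\in\Delta_0 .$$ Suppose that $g_\Theta(t)=\sum_{m\ge1}\frac{\theta_m}{m}t^m$ belongs to $\mathcal{F}(r,\vartheta,K)$, i.e. the series converges near $0$ and its sum there continues analytically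 to a function in $\mathcal{F}(r,\vartheta,K)$. Let $B_n(x)=\sum_{m=1}^{\lfloor n^x\rfloor}C_m$. Then $h_n>0$ for all sufficiently large $n$, and for every fixed $x\in[0,1]$, under $\mathbb{P}_\Theta$ on $S_n$, $$\frac{B_n(x)-x\,\vartheta\log n}{\sqrt{\vartheta\log n}}\ \overset{d}{\longrightarrow}\ \mathcal{N}(0,x)\qquad (n\to\infty),$$ where $\mathcal{N}(0,x)$ is the centred Gaussian law with variance $x$ (the point mass at $0$ if $x=0$). -/

import Mathlib

open MeasureTheory ProbabilityTheory Filter Topology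
open scoped Nat

namespace WeightedPerm

/-- The discrete σ-algebra on the symmetric group. -/
instance permMeasurableSpace (n : ℕ) : MeasurableSpace (Equiv.Perm (Fin n)) := ⊤

instance permDiscreteMeasurableSpace (n : ℕ) :
    DiscreteMeasurableSpace (Equiv.Perm (Fin n)) := ⟨fun _ => trivial⟩

/-- The number `C_m(σ)` of cycles of length `m` of `σ`. Here `σ.partition` is the full cycle type of
`σ`, a partition of `n` in which each fixed point contributes a part `1`. -/
def cycleCount {n : ℕ} (m : ℕ) (σ : Equiv.Perm (Fin n)) : ℕ :=
  σ.partition.parts.count m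

/-- `∏_i θ_{λ_i}`, where `λ` is the cycle type of `σ` (fixed points included). -/
def weight (θ : ℕ → ℝ) {n : ℕ} (σ : Equiv.Perm (Fin n)) : ℝ :=
  (σ.partition.parts.map θ).prod

/-- The normalization constant `h_n`. -/
noncomputable def normConst (θ : ℕ → ℝ) (n : ℕ) : ℝ :=
  (1 / (n ! : ℝ)) * ∑ σ : Equiv.Perm (Fin n), weight θ σ

/-- The weighted measure on the symmetric group, with mass `(1 / (h_n n!)) ∏_i θ_{λ_i}` at a
permutation of cycle type `λ`. It is a probability measure as soon as `h_n > 0`; if `h_n = 0`,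
this is the zero measure. -/
noncomputable def weightedMeasure (θ : ℕ → ℝ) (n : ℕ) : Measure (Equiv.Perm (Fin n)) :=
  ∑ σ : Equiv.Perm (Fin n),
    ENNReal.ofReal (1 / (normConst θ n * (n ! : ℝ)) * weight θ σ) • Measure.dirac σ

/-- The domain `Δ₀(r, R, α)`. -/
def delta0 (r R α : ℝ) : Set ℂ :=
  {z : ℂ | ‖z‖ < R ∧ z ≠ (r : ℂ) ∧ α < |Complex.arg (z - (r : ℂ))|}

/-- The class `𝓕(r, ϑ, K)`: functions holomorphic in some `Δ₀(r, R, α)`, `R > r`, `0 < α < π/2`,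
with `G(t) = ϑ log (1 / (1 - t/r)) + K + O(t - r)` as `t → r` in this domain. -/
def IsInF (r ϑ K : ℝ) (G : ℂ → ℂ) : Prop :=
  ∃ R α : ℝ, r < R ∧ 0 < α ∧ α < Real.pi / 2 ∧
    DifferentiableOn ℂ G (delta0 r R α) ∧
    (fun t : ℂ => G t - ((ϑ : ℂ) * Complex.log (1 / (1 - t / (r : ℂ))) + (K : ℂ)))
      =O[𝓝[delta0 r R α] (r : ℂ)] (fun t : ℂ => t - (r : ℂ))

/-- The generating function `g_Θ(t) = ∑_{m ≥ 1} (θ_m / m) t^m` belongs to `𝓕(r, ϑ, K)`: the power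
series converges near `0`, and its sum there is the germ of a function `G` in `𝓕(r, ϑ, K)`. -/
def GenFunInF (θ : ℕ → ℝ) (r ϑ K : ℝ) : Prop :=
  ∃ G : ℂ → ℂ, IsInF r ϑ K G ∧
    ∀ᶠ t in 𝓝 (0 : ℂ),
      HasSum (fun k : ℕ => ((θ (k + 1) : ℂ) / ((k : ℂ) + 1)) * t ^ (k + 1)) (G t)

/-- `B_n(x) = ∑_{1 ≤ m ≤ ⌊n^x⌋} C_m`. -/
noncomputable def cyclesUpTo (n : ℕ) (x : ℝ) (σ : Equiv.Perm (Fin n)) : ℕ :=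
  ∑ m ∈ Finset.Icc 1 ⌊(n : ℝ) ^ x⌋₊, cycleCount m σ

/-- `(B_n(x) - x ϑ log n) / √(ϑ log n)`. -/
noncomputable def normalizedCycles (ϑ : ℝ) (n : ℕ) (x : ℝ) (σ : Equiv.Perm (Fin n)) : ℝ :=
  ((cyclesUpTo n x σ : ℝ) - x * ϑ * Real.log n) / Real.sqrt (ϑ * Real.log n)

end WeightedPerm

/-! Counting permutations by cycle type turns `h_n` into the `n`-th coefficient of `exp g_Θ`.
Replacing `θ_m` by `u θ_m` for `m ≤ b` gives the numerator of the generating function of the number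
of cycles of length at most `b`. Everything is phrased through `expCoeff`, defined by the recurrence
of an exponential. With `b = ⌊n^x⌋` and `u = exp(it / √(ϑ log n))`, Lévy's continuity theorem
reduces the claim to the asymptotics of these coefficients.

Analyticity is used once, in `exists_abs_mul_pow_sub_le`: after subtraction of the logarithm, the
remainder is `O(t - r)` near `r`, its third derivative is `O(|t - r|⁻²)`, and Cauchy's formula on a
circle just inside `|t| = r` gives `θ_m r^m = ϑ + O(1/m)`. Rescaling by `r^n` makes the weights a
small perturbation of the constant (Ewens) weight `ϑ`.

For the Ewens weight, if `n ≤ b` then every cycle is marked and the generating function is exactly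
`∏_{j<n} (1 + ϑ(u-1)/(ϑ+j))`. A delay equation in `n` shows that between `n = b` and any larger `n`
it moves by only `O(|u - 1|)`, uniformly in `b` and `n` (`exists_norm_ewensMarked_sub_le`). As `u →
1`, only the product up to `b` remains.

The perturbation enters by convolution (`expCoeff_add`): dominated convergence shows that it
contributes a nonzero constant, the same in numerator and denominator
(`tendsto_expCoeff_markWeight_div_expCoeff_sub`). This also gives `h_n > 0` eventually. Finally the
logarithm of the product is `(u-1) ϑ x log n + o(1)`, whose expansion gives the centring and the
variance `x` (`tendsto_prod_ewens_mul_exp`). -/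

namespace WeightedPerm

/-! ### Counting permutations by full cycle type. -/

/-- The order `∏ m ^ c_m c_m!` of the centralizer of a permutation with cycle type `s`. -/
def centralizerOrder (s : Multiset ℕ) : ℕ :=
  s.prod * ∏ i ∈ s.toFinset, (s.count i)!

lemma centralizerOrder_cons (m : ℕ) (s : Multiset ℕ) :
    centralizerOrder (m ::ₘ s) = m * (s.count m + 1) * centralizerOrder s := by
  unfold centralizerOrder
  have h1 : ∏ i ∈ s.toFinset, (s.count i)! = ∏ i ∈ insert m s.toFinset, (s.count i)! := by
    refine Finset.prod_subset (Finset.subset_insert _ _) fun i _ hi => ?_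
    rw [Multiset.count_eq_zero_of_notMem (by simpa using hi), Nat.factorial_zero]
  rw [h1, Multiset.toFinset_cons,
    ← Finset.mul_prod_erase _ _ (Finset.mem_insert_self m s.toFinset),
    ← Finset.mul_prod_erase _ _ (Finset.mem_insert_self m s.toFinset),
    Multiset.count_cons_self, Nat.factorial_succ, Multiset.prod_cons]
  have h2 : ∀ i ∈ (insert m s.toFinset).erase m, ((m ::ₘ s).count i)! = (s.count i)! := by
    intro i hi
    rw [Multiset.count_cons_of_ne (Finset.ne_of_mem_erase hi)]
  rw [Finset.prod_congr rfl h2]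
  ring

lemma centralizerOrder_replicate_one_add (k : ℕ) (s : Multiset ℕ) (hs : 1 ∉ s) :
    centralizerOrder (Multiset.replicate k 1 + s) = k ! * centralizerOrder s := by
  induction k with
  | zero => simp
  | succ k ih =>
    rw [Multiset.replicate_succ, Multiset.cons_add, centralizerOrder_cons, ih,
      Multiset.count_add, Multiset.count_replicate_self, Multiset.count_eq_zero_of_notMem hs,
      Nat.factorial_succ]
    ring

lemma centralizerOrder_pos {s : Multiset ℕ} (hs : ∀ i ∈ s, 0 < i) : 0 < centralizerOrder s :=
  Nat.mul_pos (Multiset.prod_pos hs) (Finset.prod_pos fun _ _ => Nat.factorial_pos _)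

/-- Orbit-stabilizer for conjugacy classes. The count for `cycleType` ignores fixed points, so the
parts equal to `1` are split off; `k` of them contribute exactly `k!` to the centralizer. -/
lemma card_partition_eq_mul_centralizerOrder {n : ℕ} (p : (Fintype.card (Fin n)).Partition) :
    (Finset.univ.filter fun σ : Equiv.Perm (Fin n) => σ.partition = p).card *
      centralizerOrder p.parts = n ! := by
  set m := p.parts.filter fun i => 2 ≤ i with hm
  have hones : p.parts.filter (fun i => ¬ 2 ≤ i) =
      Multiset.replicate (Fintype.card (Fin n) - m.sum) 1 := by
    have h1 : ∀ i ∈ p.parts.filter (fun i => ¬ 2 ≤ i), i = 1 := by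
      intro i hi
      have := p.parts_pos (Multiset.mem_of_mem_filter hi)
      have := Multiset.of_mem_filter hi
      omega
    have h2 := Multiset.eq_replicate_card.2 h1
    have h3 : m.sum + (p.parts.filter (fun i => ¬ 2 ≤ i)).sum = Fintype.card (Fin n) := by
      rw [← Multiset.sum_add, hm, Multiset.filter_add_not, p.parts_sum]
    rw [h2, Multiset.sum_replicate, smul_eq_mul, mul_one] at h3
    rw [h2]
    congr 1
    omega
  have hparts : p.parts = Multiset.replicate (Fintype.card (Fin n) - m.sum) 1 + m := by
    rw [← hones, add_comm, hm, Multiset.filter_add_not]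
  have hsum : m.sum ≤ Fintype.card (Fin n) := by
    have := congrArg Multiset.sum hparts
    rw [p.parts_sum, Multiset.sum_add] at this
    omega
  have hset : (Finset.univ.filter fun σ : Equiv.Perm (Fin n) => σ.partition = p) =
      Finset.univ.filter fun σ : Equiv.Perm (Fin n) => σ.cycleType = m := by
    ext σ
    simp only [Finset.mem_filter, Finset.mem_univ, true_and]
    constructor
    · rintro rfl
      rw [hm, Equiv.Perm.filter_parts_partition_eq_cycleType]
    · intro h
      ext1
      rw [Equiv.Perm.parts_partition, ← Equiv.Perm.sum_cycleType, h, add_comm]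
      exact hparts.symm
  have key := Equiv.Perm.card_of_cycleType_mul_eq (Fin n) m
  rw [if_pos ⟨hsum, fun a ha => Multiset.of_mem_filter ha⟩] at key
  have h1m : 1 ∉ m := fun h => by simpa using Multiset.of_mem_filter h
  rw [hset, hparts, centralizerOrder_replicate_one_add _ _ h1m]
  rw [Fintype.card_fin] at key ⊢
  rw [← key, centralizerOrder]
  ring

/-! ### Exponential coefficients and the cycle index. -/

section Coefficients

variable {F : Type*} [Field F]

/-- The coefficients of the formal power series `exp (∑ w_m t ^ m / m)`, given by the recurrence
`(n + 1) a_{n + 1} = ∑_{k ≤ n} w_{k + 1} a_{n - k}`. -/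
def expCoeff (w : ℕ → F) : ℕ → F
  | 0 => 1
  | n + 1 => (∑ k : Fin (n + 1), w (k + 1) * expCoeff w (n - k)) / ((n : F) + 1)

@[simp] lemma expCoeff_zero (w : ℕ → F) : expCoeff w 0 = 1 := by rw [expCoeff]

lemma expCoeff_succ' (w : ℕ → F) (n : ℕ) : expCoeff w (n + 1) =
    (∑ k ∈ Finset.range (n + 1), w (k + 1) * expCoeff w (n - k)) / ((n : F) + 1) := by
  rw [expCoeff, Finset.sum_range]

lemma expCoeff_succ [CharZero F] (w : ℕ → F) (n : ℕ) : ((n : F) + 1) * expCoeff w (n + 1) =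
    ∑ k ∈ Finset.range (n + 1), w (k + 1) * expCoeff w (n - k) := by
  rw [expCoeff_succ', mul_div_cancel₀ _ (Nat.cast_add_one_ne_zero n)]

lemma eq_expCoeff [CharZero F] {w a : ℕ → F} (h0 : a 0 = 1)
    (h : ∀ n : ℕ, ((n : F) + 1) * a (n + 1) =
      ∑ k ∈ Finset.range (n + 1), w (k + 1) * a (n - k)) (n : ℕ) : a n = expCoeff w n := by
  induction n using Nat.strong_induction_on with
  | _ n ih =>
    cases n with
    | zero => simp [h0]
    | succ n =>
      apply mul_left_cancel₀ (Nat.cast_add_one_ne_zero n : (n : F) + 1 ≠ 0)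
      rw [h, expCoeff_succ]
      refine Finset.sum_congr rfl fun k _ => ?_
      rw [ih (n - k) (by omega)]

/-- Write `n + 1 = ∑ (k+1) c_{k+1}` for each partition and delete one part `k + 1`. The factor
`(k+1) c_{k+1}` is precisely the change in the centralizer order, so what is left is the sum over
partitions of `n - k`. -/
lemma sum_partition_eq_expCoeff [CharZero F] (w : ℕ → F) (n : ℕ) :
    ∑ p : n.Partition, (p.parts.map w).prod / (centralizerOrder p.parts : F) = expCoeff w n := by
  refine eq_expCoeff (a := fun n => ∑ p : n.Partition,
    (p.parts.map w).prod / (centralizerOrder p.parts : F)) ?_ (fun n => ?_) n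
  · rw [Fintype.sum_eq_single (default : Nat.Partition 0) fun p hp => absurd
      (Subsingleton.elim p default) hp]
    simp [centralizerOrder]
  · have hsplit : ∀ p : (n + 1).Partition, ((n : F) + 1) =
        ∑ k ∈ Finset.range (n + 1), ((k : F) + 1) * (p.parts.count (k + 1) : F) := by
      intro p
      have h1 : (∑ k ∈ Finset.range (n + 1), (k + 1) * p.parts.count (k + 1)) = n + 1 := by
        conv_rhs => rw [← p.parts_sum]
        rw [Finset.sum_multiset_count_of_subset p.parts (Finset.Icc 1 (n + 1))]
        · rw [Finset.range_eq_Ico, Finset.sum_Ico_add' (fun k => k * p.parts.count k) 0 (n + 1) 1]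
          refine Finset.sum_congr (by ext; simp) fun k _ => ?_
          rw [smul_eq_mul, mul_comm]
        · intro i hi
          rw [Multiset.mem_toFinset] at hi
          exact Finset.mem_Icc.2 ⟨p.parts_pos hi, Nat.Partition.le_of_mem_parts hi⟩
      have := congrArg (Nat.cast : ℕ → F) h1
      push_cast at this
      exact this.symm
    rw [Finset.mul_sum]
    have hterm : ∀ p : (n + 1).Partition, ((n : F) + 1) * ((p.parts.map w).prod /
        (centralizerOrder p.parts : F)) = ∑ k ∈ Finset.range (n + 1),
          ((k : F) + 1) * (p.parts.count (k + 1) : F) * ((p.parts.map w).prod /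
            (centralizerOrder p.parts : F)) := fun p => by
      rw [← Finset.sum_mul, ← hsplit]
    rw [Finset.sum_congr rfl fun p _ => hterm p, Finset.sum_comm]
    refine Finset.sum_congr rfl fun k hk => ?_
    have hk' : k + 1 ≤ n + 1 := by have := Finset.mem_range.1 hk; omega
    have hsub : n + 1 - (k + 1) = n - k := by omega
    rw [← hsub, Finset.mul_sum,
      ← Equiv.sum_comp (Nat.Partition.partitionWithPartEquiv (Nat.succ_pos k) hk'),
      ← Finset.sum_subset (Finset.filter_subset (fun p : (n + 1).Partition => k + 1 ∈ p.parts)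
        Finset.univ)]
    · rw [Finset.sum_subtype (p := fun p : (n + 1).Partition => k + 1 ∈ p.parts) _ (by simp)]
      refine Finset.sum_congr rfl fun p _ => ?_
      obtain ⟨p, hp⟩ := p
      obtain ⟨s, hs⟩ := Multiset.exists_cons_of_mem hp
      have hs0 : (centralizerOrder s : F) ≠ 0 := Nat.cast_ne_zero.2 (centralizerOrder_pos
        fun i hi => p.parts_pos (by rw [hs]; exact Multiset.mem_cons_of_mem hi)).ne'
      have hk0 : (k : F) + 1 ≠ 0 := Nat.cast_add_one_ne_zero k
      have hc0 : (s.count (k + 1) : F) + 1 ≠ 0 := Nat.cast_add_one_ne_zero _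
      simp only [Nat.Partition.partitionWithPartEquiv_apply_parts, hs, Multiset.erase_cons_head,
        Multiset.map_cons, Multiset.prod_cons, centralizerOrder_cons, Multiset.count_cons_self]
      push_cast
      field_simp
    · intro p _ hp
      rw [Multiset.count_eq_zero_of_notMem (by simpa using hp)]
      simp

lemma sum_perm_eq_expCoeff [CharZero F] (w : ℕ → F) (n : ℕ) :
    (1 / (n ! : F)) * ∑ σ : Equiv.Perm (Fin n), (σ.partition.parts.map w).prod =
      expCoeff w n := by
  have hn : (n ! : F) ≠ 0 := Nat.cast_ne_zero.2 (Nat.factorial_ne_zero n)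
  have hfib := Finset.sum_fiberwise (Finset.univ : Finset (Equiv.Perm (Fin n)))
    (fun σ => σ.partition) (fun σ => (σ.partition.parts.map w).prod)
  rw [← hfib, ← sum_partition_eq_expCoeff, Finset.mul_sum]
  have h : ∑ p : (Fintype.card (Fin n)).Partition,
      (p.parts.map w).prod / (centralizerOrder p.parts : F) =
      ∑ p : n.Partition, (p.parts.map w).prod / (centralizerOrder p.parts : F) := by
    rw [Fintype.card_fin]
  rw [← h]
  refine Finset.sum_congr rfl fun p _ => ?_
  have hz : (centralizerOrder p.parts : F) ≠ 0 :=
    Nat.cast_ne_zero.2 (centralizerOrder_pos fun i hi => p.parts_pos hi).ne'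
  have hc := congrArg (Nat.cast : ℕ → F) (card_partition_eq_mul_centralizerOrder p)
  push_cast at hc
  rw [Finset.sum_congr rfl (g := fun _ => (p.parts.map w).prod)
    (fun σ hσ => by rw [(Finset.mem_filter.1 hσ).2]), Finset.sum_const, nsmul_eq_mul, ← hc]
  have hc0 : ((Finset.univ.filter fun σ : Equiv.Perm (Fin n) => σ.partition = p).card : F) ≠ 0 :=
    fun h => hn (by rw [← hc, h, zero_mul])
  field_simp

end Coefficients

/-! ### Algebra of exponential coefficients. -/

section Coefficients

variable {F : Type*} [Field F]

lemma expCoeff_congr {w w' : ℕ → F} {n : ℕ} (h : ∀ m, 1 ≤ m → m ≤ n → w m = w' m) :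
    expCoeff w n = expCoeff w' n := by
  induction n using Nat.strong_induction_on with
  | _ n ih =>
    cases n with
    | zero => simp
    | succ n =>
      rw [expCoeff_succ', expCoeff_succ']
      congr 1
      refine Finset.sum_congr rfl fun k hk => ?_
      have := Finset.mem_range.1 hk
      rw [h (k + 1) (by omega) (by omega),
        ih (n - k) (by omega) fun m h1 h2 => h m h1 (by omega)]

lemma derivative_mk_expCoeff [CharZero F] (w : ℕ → F) :
    PowerSeries.derivative F (PowerSeries.mk (expCoeff w)) =
      PowerSeries.mk (fun k => w (k + 1)) * PowerSeries.mk (expCoeff w) := by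
  ext n
  rw [PowerSeries.coeff_derivative, PowerSeries.coeff_mk, mul_comm, expCoeff_succ,
    PowerSeries.coeff_mul, Finset.Nat.sum_antidiagonal_eq_sum_range_succ_mk]
  simp

/-- The exponential of a sum is a product: both sides solve the same first-order linear differential
equation for formal power series with constant term `1`. -/
lemma expCoeff_add [CharZero F] (w w' : ℕ → F) (n : ℕ) :
    expCoeff (fun m => w m + w' m) n =
      ∑ k ∈ Finset.range (n + 1), expCoeff w k * expCoeff w' (n - k) := by
  set A := PowerSeries.mk (expCoeff w) with hA
  set B := PowerSeries.mk (expCoeff w') with hB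
  have hcoeff : ∀ n, PowerSeries.coeff n (A * B) =
      ∑ k ∈ Finset.range (n + 1), expCoeff w k * expCoeff w' (n - k) := fun n => by
    rw [PowerSeries.coeff_mul, Finset.Nat.sum_antidiagonal_eq_sum_range_succ_mk]
    simp [hA, hB]
  rw [← hcoeff]
  symm
  refine eq_expCoeff (a := fun n => PowerSeries.coeff n (A * B)) (by simp [hA, hB]) (fun n => ?_) n
  have hd : PowerSeries.derivative F (A * B) =
      PowerSeries.mk (fun k => w (k + 1) + w' (k + 1)) * (A * B) := by
    have hsum : PowerSeries.mk (fun k => w (k + 1) + w' (k + 1)) =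
        PowerSeries.mk (fun k => w (k + 1)) + PowerSeries.mk (fun k => w' (k + 1)) := by
      ext; simp
    rw [Derivation.leibniz, hA, hB, derivative_mk_expCoeff, derivative_mk_expCoeff, hsum]
    simp only [smul_eq_mul]
    ring
  have h := congrArg (PowerSeries.coeff n) hd
  rw [PowerSeries.coeff_derivative, PowerSeries.coeff_mul n (PowerSeries.mk _),
    Finset.Nat.sum_antidiagonal_eq_sum_range_succ_mk] at h
  simp only [PowerSeries.coeff_mk] at h
  rw [mul_comm]
  exact h

lemma expCoeff_mul_pow [CharZero F] (w : ℕ → F) (r : F) (n : ℕ) :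
    expCoeff (fun m => w m * r ^ m) n = r ^ n * expCoeff w n := by
  symm
  refine eq_expCoeff (a := fun n => r ^ n * expCoeff w n) (by simp) (fun n => ?_) n
  rw [mul_left_comm, expCoeff_succ, Finset.mul_sum]
  refine Finset.sum_congr rfl fun k hk => ?_
  have : n + 1 = (k + 1) + (n - k) := by have := Finset.mem_range.1 hk; omega
  rw [this, pow_add]
  ring

lemma expCoeff_zero_weight (n : ℕ) :
    expCoeff (fun _ => (0 : F)) n = if n = 0 then 1 else 0 := by
  cases n with
  | zero => simp
  | succ n => rw [expCoeff_succ']; simp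

lemma expCoeff_const [CharZero F] (s : F) (n : ℕ) :
    expCoeff (fun _ => s) n = ∏ j ∈ Finset.range n, (s + j) / (j + 1) := by
  symm
  refine eq_expCoeff (a := fun n => ∏ j ∈ Finset.range n, (s + j) / ((j : F) + 1)) (by simp)
    (fun n => ?_) n
  have hr := Finset.sum_range_reflect
    (fun k => ∏ j ∈ Finset.range k, (s + j) / ((j : F) + 1)) (n + 1)
  simp only [Nat.add_sub_cancel] at hr
  rw [← Finset.mul_sum, hr]
  clear hr
  induction n with
  | zero => simp
  | succ n ih =>
    rw [Finset.sum_range_succ, mul_add, ← ih, Finset.prod_range_succ _ (n + 1)]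
    have : ((n + 1 : ℕ) : F) + 1 ≠ 0 := Nat.cast_add_one_ne_zero (n + 1)
    field_simp
    push_cast
    ring

lemma expCoeff_const_succ [CharZero F] (s : F) (n : ℕ) :
    ((n : F) + 1) * expCoeff (fun _ => s) (n + 1) = (n + s) * expCoeff (fun _ => s) n := by
  rw [expCoeff_const, expCoeff_const, Finset.prod_range_succ]
  have : (n : F) + 1 ≠ 0 := Nat.cast_add_one_ne_zero n
  field_simp
  ring

end Coefficients

/-! ### Bounds, summability and limits of exponential coefficients. -/

lemma expCoeff_ofReal (w : ℕ → ℝ) (n : ℕ) :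
    expCoeff (fun m => (w m : ℂ)) n = ((expCoeff w n : ℝ) : ℂ) := by
  symm
  refine eq_expCoeff (a := fun n => ((expCoeff w n : ℝ) : ℂ)) (by simp) (fun n => ?_) n
  have := congrArg (Complex.ofReal) (expCoeff_succ w n)
  push_cast at this
  exact this

lemma norm_expCoeff_le {w : ℕ → ℂ} {v : ℕ → ℝ} (h : ∀ m, 1 ≤ m → ‖w m‖ ≤ v m) (n : ℕ) :
    ‖expCoeff w n‖ ≤ expCoeff v n := by
  induction n using Nat.strong_induction_on with
  | _ n ih =>
    cases n with
    | zero => simp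
    | succ n =>
      have hn : ‖(n : ℂ) + 1‖ = (n : ℝ) + 1 := by
        rw [← Nat.cast_succ, Complex.norm_natCast, Nat.cast_succ]
      rw [expCoeff_succ', expCoeff_succ', norm_div, hn]
      gcongr
      refine (norm_sum_le _ _).trans (Finset.sum_le_sum fun k _ => ?_)
      rw [norm_mul]
      have hk := h (k + 1) (by omega)
      have := ih (n - k) (by omega)
      have := norm_nonneg (w (k + 1))
      gcongr
      linarith

lemma expCoeff_nonneg {w : ℕ → ℝ} (h : ∀ m, 1 ≤ m → 0 ≤ w m) (n : ℕ) : 0 ≤ expCoeff w n :=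
  (norm_nonneg _).trans (norm_expCoeff_le (w := fun m => (w m : ℂ))
    (fun m hm => by rw [Complex.norm_real, Real.norm_of_nonneg (h m hm)]) n)

/-- In the recurrence, `v (n+1) ≤ v (k+1) * v (n-k)` distributes the factor over the two terms. This
lets a submultiplicative growth factor be absorbed into the weights. -/
lemma mul_expCoeff_le {w v : ℕ → ℝ} (hw : ∀ m, 1 ≤ m → 0 ≤ w m) (hv0 : v 0 = 1)
    (hv : ∀ m, 0 ≤ v m) (hmul : ∀ a b, v (a + b) ≤ v a * v b) (n : ℕ) :
    v n * expCoeff w n ≤ expCoeff (fun m => v m * w m) n := by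
  induction n using Nat.strong_induction_on with
  | _ n ih =>
    cases n with
    | zero => simp [hv0]
    | succ n =>
      rw [expCoeff_succ', expCoeff_succ', mul_div_assoc', Finset.mul_sum]
      refine div_le_div_of_nonneg_right (Finset.sum_le_sum fun k hk => ?_) (by positivity)
      have hk := Finset.mem_range.1 hk
      have h1 := hmul (k + 1) (n - k)
      rw [show k + 1 + (n - k) = n + 1 by omega] at h1
      have h2 := hw (k + 1) (by omega)
      have h3 := expCoeff_nonneg hw (n - k)
      calc v (n + 1) * (w (k + 1) * expCoeff w (n - k))
          ≤ (v (k + 1) * v (n - k)) * (w (k + 1) * expCoeff w (n - k)) := by gcongr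
        _ = v (k + 1) * w (k + 1) * (v (n - k) * expCoeff w (n - k)) := by ring
        _ ≤ _ := mul_le_mul_of_nonneg_left (ih (n - k) (by omega)) (mul_nonneg (hv _) h2)

/-- The truncated polynomials satisfy `f' ≤ g' f` on `[0, 1]`, since truncation only discards
nonnegative terms of the product. Hence `f exp(-g)` decreases from its value `1` at `0`. -/
lemma sum_expCoeff_le_exp {w : ℕ → ℝ} (hw : ∀ m, 1 ≤ m → 0 ≤ w m) (N : ℕ) :
    ∑ n ∈ Finset.range (N + 1), expCoeff w n ≤
      Real.exp (∑ k ∈ Finset.range N, w (k + 1) / ((k : ℝ) + 1)) := by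
  set f : ℝ → ℝ := fun t => ∑ n ∈ Finset.range (N + 1), expCoeff w n * t ^ n with hf
  set g : ℝ → ℝ := fun t => ∑ k ∈ Finset.range N, w (k + 1) / ((k : ℝ) + 1) * t ^ (k + 1) with hg
  have hg' : ∀ t, HasDerivAt g (∑ k ∈ Finset.range N, w (k + 1) * t ^ k) t := by
    intro t
    refine HasDerivAt.fun_sum fun k _ => ?_
    convert! ((hasDerivAt_pow (k + 1) t).const_mul (w (k + 1) / ((k : ℝ) + 1))) using 1
    have : (k : ℝ) + 1 ≠ 0 := by positivity
    push_cast
    field_simp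
  have hf' : ∀ t, HasDerivAt f
      (∑ n ∈ Finset.range N, ((n : ℝ) + 1) * expCoeff w (n + 1) * t ^ n) t := by
    intro t
    have : f = fun t => ∑ n ∈ Finset.range N, expCoeff w (n + 1) * t ^ (n + 1) + 1 := by
      funext t
      simp [hf, Finset.sum_range_succ']
    rw [this]
    refine HasDerivAt.add_const _ (HasDerivAt.fun_sum fun k _ => ?_)
    convert! ((hasDerivAt_pow (k + 1) t).const_mul (expCoeff w (k + 1))) using 1
    push_cast
    ring
  have hle : ∀ t, 0 ≤ t → ∑ n ∈ Finset.range N, ((n : ℝ) + 1) * expCoeff w (n + 1) * t ^ n ≤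
      (∑ k ∈ Finset.range N, w (k + 1) * t ^ k) * f t := by
    intro t ht
    have h1 : ∀ n : ℕ, ((n : ℝ) + 1) * expCoeff w (n + 1) * t ^ n = ∑ k ∈ Finset.range (n + 1),
        (w (k + 1) * t ^ k) * (expCoeff w (n - k) * t ^ (n - k)) := by
      intro n
      rw [expCoeff_succ, Finset.sum_mul]
      refine Finset.sum_congr rfl fun k hk => ?_
      have : t ^ n = t ^ k * t ^ (n - k) := by
        rw [← pow_add]; congr 1; have := Finset.mem_range.1 hk; omega
      rw [this]
      ring
    rw [Finset.sum_congr rfl fun n _ => h1 n, Finset.sum_range_diag_flip N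
      fun k j => (w (k + 1) * t ^ k) * (expCoeff w j * t ^ j), Finset.sum_mul]
    refine Finset.sum_le_sum fun k _ => ?_
    rw [← Finset.mul_sum]
    refine mul_le_mul_of_nonneg_left ?_ (mul_nonneg (hw _ (by omega)) (by positivity))
    refine Finset.sum_le_sum_of_subset_of_nonneg
      (Finset.range_subset_range.2 (by omega)) fun j _ _ => ?_
    exact mul_nonneg (expCoeff_nonneg hw j) (by positivity)
  have hF : ∀ t, HasDerivAt (fun t => f t * Real.exp (-g t))
      ((∑ n ∈ Finset.range N, ((n : ℝ) + 1) * expCoeff w (n + 1) * t ^ n) * Real.exp (-g t) +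
        f t * (Real.exp (-g t) * -(∑ k ∈ Finset.range N, w (k + 1) * t ^ k))) t :=
    fun t => (hf' t).mul ((hg' t).neg.exp)
  have hanti : AntitoneOn (fun t => f t * Real.exp (-g t)) (Set.Icc 0 1) := by
    refine antitoneOn_of_deriv_nonpos (convex_Icc 0 1)
      (fun t _ => (hF t).continuousAt.continuousWithinAt)
      (fun t _ => (hF t).differentiableAt.differentiableWithinAt) fun t ht => ?_
    rw [interior_Icc] at ht
    rw [(hF t).deriv]
    nlinarith [hle t ht.1.le, Real.exp_pos (-g t)]
  have h01 := hanti (Set.left_mem_Icc.2 zero_le_one) (Set.right_mem_Icc.2 zero_le_one) zero_le_one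
  have hf0 : f 0 = 1 := by simp [hf, Finset.sum_range_succ']
  have hg0 : g 0 = 0 := by simp [hg]
  have hf1 : f 1 = ∑ n ∈ Finset.range (N + 1), expCoeff w n := by simp [hf]
  have hg1 : g 1 = ∑ k ∈ Finset.range N, w (k + 1) / ((k : ℝ) + 1) := by simp [hg]
  simp only [hf0, hg0, neg_zero, Real.exp_zero, mul_one, Real.exp_neg] at h01
  rw [← hf1, ← hg1]
  rwa [← div_eq_mul_inv, div_le_one (Real.exp_pos _)] at h01

lemma summable_expCoeff {w : ℕ → ℝ} (hw : ∀ m, 1 ≤ m → 0 ≤ w m)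
    (hs : Summable fun k : ℕ => w (k + 1) / ((k : ℝ) + 1)) : Summable (expCoeff w) := by
  refine summable_of_sum_range_le (c := Real.exp (∑' k : ℕ, w (k + 1) / ((k : ℝ) + 1)))
    (expCoeff_nonneg hw) fun n => ?_
  calc ∑ i ∈ Finset.range n, expCoeff w i ≤ ∑ i ∈ Finset.range (n + 1), expCoeff w i :=
        Finset.sum_le_sum_of_subset_of_nonneg (Finset.range_subset_range.2 (by omega))
          fun j _ _ => expCoeff_nonneg hw j
    _ ≤ _ := sum_expCoeff_le_exp hw n
    _ ≤ _ := Real.exp_le_exp.2 (hs.sum_le_tsum _ fun k _ =>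
        div_nonneg (hw _ (by omega)) (by positivity))

lemma tendsto_expCoeff {ι : Type*} {l : Filter ι} {w : ι → ℕ → ℂ} {w₀ : ℕ → ℂ}
    (h : ∀ m, 1 ≤ m → Tendsto (fun i => w i m) l (𝓝 (w₀ m))) (n : ℕ) :
    Tendsto (fun i => expCoeff (w i) n) l (𝓝 (expCoeff w₀ n)) := by
  induction n using Nat.strong_induction_on with
  | _ n ih =>
    cases n with
    | zero => simp only [expCoeff_zero, tendsto_const_nhds]
    | succ n =>
      simp only [expCoeff_succ']
      refine Tendsto.div_const (tendsto_finsetSum _ fun k _ => ?_) _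
      exact (h (k + 1) (by omega)).mul (ih (n - k) (by omega))

/-- An exponential does not vanish: the Cauchy product with the series of the weights `-w` is `1`.
-/
lemma tsum_expCoeff_ne_zero {w : ℕ → ℂ} (hs : Summable fun k : ℕ => ‖w (k + 1)‖ / ((k : ℝ) + 1)) :
    ∑' n, expCoeff w n ≠ 0 := by
  have h1 : Summable fun n => ‖expCoeff w n‖ :=
    Summable.of_nonneg_of_le (fun _ => norm_nonneg _)
      (fun n => norm_expCoeff_le (v := fun m => ‖w m‖) (fun _ _ => le_rfl) n)
      (summable_expCoeff (fun _ _ => norm_nonneg _) hs)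
  have h2 : Summable fun n => ‖expCoeff (fun m => -w m) n‖ :=
    Summable.of_nonneg_of_le (fun _ => norm_nonneg _)
      (fun n => norm_expCoeff_le (v := fun m => ‖w m‖) (fun _ _ => (norm_neg _).le) n)
      (summable_expCoeff (fun _ _ => norm_nonneg _) hs)
  have h3 := tsum_mul_tsum_eq_tsum_sum_range_of_summable_norm h1 h2
  have h4 : ∀ n, ∑ k ∈ Finset.range (n + 1), expCoeff w k * expCoeff (fun m => -w m) (n - k) =
      if n = 0 then 1 else 0 := fun n => by
    rw [← expCoeff_add, ← expCoeff_zero_weight (F := ℂ)]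
    simp
  rw [tsum_congr h4, tsum_ite_eq] at h3
  exact left_ne_zero_of_mul (h3.trans_ne one_ne_zero)

/-! ### Ewens coefficients and their ratios. -/

/-- The coefficients of `(1 - t) ^ (-ϑ)`. -/
noncomputable def ewensCoeff (ϑ : ℝ) (n : ℕ) : ℝ := expCoeff (fun _ => ϑ) n

section Ewens

variable {ϑ : ℝ}

lemma ewensCoeff_pos (hϑ : 0 < ϑ) (n : ℕ) : 0 < ewensCoeff ϑ n := by
  rw [ewensCoeff, expCoeff_const]
  exact Finset.prod_pos fun j _ => by positivity

lemma ewensCoeff_succ (ϑ : ℝ) (n : ℕ) :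
    ((n : ℝ) + 1) * ewensCoeff ϑ (n + 1) = (n + ϑ) * ewensCoeff ϑ n :=
  expCoeff_const_succ ϑ n

lemma mul_sum_ewensCoeff (ϑ : ℝ) (n : ℕ) :
    ϑ * ∑ k ∈ Finset.range (n + 1), ewensCoeff ϑ k = (n + ϑ) * ewensCoeff ϑ n := by
  rw [← ewensCoeff_succ, ewensCoeff, expCoeff_succ, ← Finset.mul_sum]
  have hr := Finset.sum_range_reflect (ewensCoeff ϑ) (n + 1)
  simp only [Nat.add_sub_cancel] at hr
  rw [← hr]
  rfl

lemma mul_ewensCoeff_le (hϑ : 0 < ϑ) {k n : ℕ} (h : k ≤ n) :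
    ϑ * ewensCoeff ϑ k ≤ (n + ϑ) * ewensCoeff ϑ n := by
  rw [← mul_sum_ewensCoeff]
  gcongr
  exact Finset.single_le_sum (fun i _ => (ewensCoeff_pos hϑ i).le)
    (Finset.mem_range.2 (by omega))

/-- A submultiplicative bound for the ratios `ewensCoeff ϑ (n - k) / ewensCoeff ϑ n`. -/
noncomputable def ratioBound (ϑ : ℝ) (k : ℕ) : ℝ :=
  ∏ j ∈ Finset.range k, ((j : ℝ) + 1) / (j + min ϑ 1)

lemma ratioBound_zero (ϑ : ℝ) : ratioBound ϑ 0 = 1 := by simp [ratioBound]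

lemma ratioBound_succ (ϑ : ℝ) (k : ℕ) :
    ratioBound ϑ (k + 1) = ratioBound ϑ k * (((k : ℝ) + 1) / (k + min ϑ 1)) := by
  rw [ratioBound, Finset.prod_range_succ, ratioBound]

lemma ratioBound_pos (hϑ : 0 < ϑ) (k : ℕ) : 0 < ratioBound ϑ k := by
  have : 0 < min ϑ 1 := lt_min hϑ one_pos
  exact Finset.prod_pos fun j _ => by positivity

/-- Since `min ϑ 1 ≤ 1`, the factors `(j+1)/(j + min ϑ 1)` decrease in `j`; a factor of index `a +
b` is at most the one of index `b`. -/
lemma ratioBound_add_le (hϑ : 0 < ϑ) (a b : ℕ) :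
    ratioBound ϑ (a + b) ≤ ratioBound ϑ a * ratioBound ϑ b := by
  have hm : 0 < min ϑ 1 := lt_min hϑ one_pos
  have hm1 : min ϑ 1 ≤ 1 := min_le_right _ _
  induction b with
  | zero => simp [ratioBound_zero]
  | succ b ih =>
    rw [← add_assoc, ratioBound_succ, ratioBound_succ, ← mul_assoc]
    refine mul_le_mul ih ?_ (by positivity)
      (mul_pos (ratioBound_pos hϑ a) (ratioBound_pos hϑ b)).le
    rw [div_le_div_iff₀ (by positivity) (by positivity)]
    push_cast
    nlinarith [mul_nonneg (Nat.cast_nonneg (α := ℝ) a) (sub_nonneg.2 hm1)]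

/-- The bound is uniform in `m`, which makes it usable as a dominating function when `k` is fixed
and `n → ∞`. -/
lemma ewensCoeff_le_ratioBound_mul (hϑ : 0 < ϑ) (m k : ℕ) :
    ewensCoeff ϑ m ≤ ratioBound ϑ k * ewensCoeff ϑ (m + k) := by
  have hm : 0 < min ϑ 1 := lt_min hϑ one_pos
  have hm1 : min ϑ 1 ≤ 1 := min_le_right _ _
  have hm2 : min ϑ 1 ≤ ϑ := min_le_left _ _
  induction k with
  | zero => simp [ratioBound_zero]
  | succ k ih =>
    refine ih.trans ?_
    rw [ratioBound_succ, mul_assoc]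
    refine mul_le_mul_of_nonneg_left ?_ (ratioBound_pos hϑ k).le
    have h := ewensCoeff_succ ϑ (m + k)
    have hp := ewensCoeff_pos hϑ (m + k)
    have hmk : (0 : ℝ) < ((m + k : ℕ) : ℝ) + 1 := by positivity
    have h' : ewensCoeff ϑ (m + (k + 1)) =
        (((m + k : ℕ) : ℝ) + ϑ) * ewensCoeff ϑ (m + k) / (((m + k : ℕ) : ℝ) + 1) := by
      rw [← h, ← add_assoc]
      field_simp
    rw [h', div_mul_div_comm, le_div_iff₀ (by positivity)]
    push_cast
    have hk0 : (0 : ℝ) ≤ k := Nat.cast_nonneg k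
    have hm0 : (0 : ℝ) ≤ m := Nat.cast_nonneg m
    have : ((k : ℝ) + min ϑ 1) * (m + k + 1) ≤ ((k : ℝ) + 1) * (m + k + ϑ) := by
      nlinarith [mul_nonneg hm0 (sub_nonneg.2 hm1), mul_nonneg hk0 (sub_nonneg.2 hm2)]
    nlinarith

lemma ratioBound_succ_le (hϑ : 0 < ϑ) (k : ℕ) :
    ratioBound ϑ (k + 1) ≤ (min ϑ 1)⁻¹ * ((k : ℝ) + 1) ^ (1 - min ϑ 1) := by
  have hm : 0 < min ϑ 1 := lt_min hϑ one_pos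
  have hm1 : min ϑ 1 ≤ 1 := min_le_right _ _
  induction k with
  | zero => simp [ratioBound]
  | succ k ih =>
    rw [ratioBound_succ]
    have hk : (0 : ℝ) < (k : ℝ) + 1 := by positivity
    have hk2 : (0 : ℝ) < (k : ℝ) + 2 := by positivity
    -- Bernoulli's inequality for `((k+1)/(k+2))^(1 - min ϑ 1)`; the exponent lies in `[0, 1]`.
    have hb := rpow_one_add_le_one_add_mul_self (s := -(1 / ((k : ℝ) + 2)))
      (p := 1 - min ϑ 1) (by
        rw [neg_le_neg_iff, div_le_one hk2]; linarith) (by linarith) (by linarith)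
    have h1 : 1 + -(1 / ((k : ℝ) + 2)) = ((k : ℝ) + 1) / (k + 2) := by field_simp; ring
    have h2 : 1 + (1 - min ϑ 1) * -(1 / ((k : ℝ) + 2)) = (k + 1 + min ϑ 1) / (k + 2) := by
      field_simp; ring
    rw [h1, h2, Real.div_rpow hk.le hk2.le, div_le_div_iff₀ (by positivity) hk2] at hb
    calc ratioBound ϑ (k + 1) * ((((k + 1 : ℕ) : ℝ) + 1) / (((k + 1 : ℕ) : ℝ) + min ϑ 1))
        ≤ ((min ϑ 1)⁻¹ * ((k : ℝ) + 1) ^ (1 - min ϑ 1)) *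
          ((((k + 1 : ℕ) : ℝ) + 1) / (((k + 1 : ℕ) : ℝ) + min ϑ 1)) := by gcongr
      _ = (min ϑ 1)⁻¹ * ((((k : ℝ) + 1) ^ (1 - min ϑ 1) * (k + 2)) / (k + 1 + min ϑ 1)) := by
          push_cast; ring
      _ ≤ (min ϑ 1)⁻¹ * ((((k + 1 : ℕ) : ℝ) + 1) ^ (1 - min ϑ 1)) := by
          gcongr
          rw [div_le_iff₀ (by positivity)]
          push_cast
          rw [show (k : ℝ) + 1 + 1 = k + 2 by ring]
          linarith

lemma tendsto_ewensCoeff_ratio (hϑ : 0 < ϑ) (k : ℕ) :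
    Tendsto (fun n => ewensCoeff ϑ (n - k) / ewensCoeff ϑ n) atTop (𝓝 1) := by
  have h1 : Tendsto (fun n : ℕ => ewensCoeff ϑ n / ewensCoeff ϑ (n + 1)) atTop (𝓝 1) := by
    have h2 : Tendsto (fun n : ℕ => 1 + (1 - ϑ) / ((n : ℝ) + ϑ)) atTop (𝓝 (1 + 0)) :=
      tendsto_const_nhds.add (Tendsto.div_atTop tendsto_const_nhds
        (tendsto_atTop_add_const_right _ _ tendsto_natCast_atTop_atTop))
    rw [add_zero] at h2
    refine h2.congr fun n => ?_
    have := ewensCoeff_succ ϑ n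
    have hp := ewensCoeff_pos hϑ n
    have hp' := ewensCoeff_pos hϑ (n + 1)
    have hn : 0 < (n : ℝ) + ϑ := by positivity
    rw [eq_div_iff hp'.ne']
    field_simp
    linarith
  induction k with
  | zero =>
    refine tendsto_const_nhds.congr fun n => ?_
    rw [Nat.sub_zero, div_self (ewensCoeff_pos hϑ n).ne']
  | succ k ih =>
    have h3 := (h1.comp (tendsto_sub_atTop_nat (k + 1))).mul ih
    rw [mul_one] at h3
    refine h3.congr' ?_
    filter_upwards [eventually_ge_atTop (k + 1)] with n hn
    rw [Function.comp_apply, show n - (k + 1) + 1 = n - k by omega,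
      div_mul_div_cancel₀ (ewensCoeff_pos hϑ _).ne']

lemma abs_log_ewensCoeff_succ_sub_le (hϑ : 0 < ϑ) (j : ℕ) :
    |Real.log (ewensCoeff ϑ j) - Real.log (ewensCoeff ϑ (j + 1))| ≤
      |ϑ - 1| / min ϑ 1 / ((j : ℝ) + 1) := by
  have hm : 0 < min ϑ 1 := lt_min hϑ one_pos
  have hj : (0 : ℝ) ≤ j := Nat.cast_nonneg j
  have hp := ewensCoeff_pos hϑ j
  have hp' := ewensCoeff_pos hϑ (j + 1)
  have hs := ewensCoeff_succ ϑ j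
  have hr : ewensCoeff ϑ j / ewensCoeff ϑ (j + 1) = ((j : ℝ) + 1) / (j + ϑ) := by
    rw [div_eq_div_iff hp'.ne' (by positivity)]
    linarith
  rw [← Real.log_div hp.ne' hp'.ne', hr, abs_le]
  have h1 : Real.log (((j : ℝ) + 1) / (j + ϑ)) ≤ (1 - ϑ) / (j + ϑ) := by
    refine (Real.log_le_sub_one_of_pos (by positivity)).trans (le_of_eq ?_)
    field_simp
    ring
  have h2 : -Real.log (((j : ℝ) + 1) / (j + ϑ)) ≤ (ϑ - 1) / (j + 1) := by
    rw [← Real.log_inv, inv_div]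
    refine (Real.log_le_sub_one_of_pos (by positivity)).trans (le_of_eq ?_)
    field_simp
    ring
  have h3 : (1 - ϑ) / (j + ϑ) ≤ |ϑ - 1| / min ϑ 1 / ((j : ℝ) + 1) := by
    rw [div_div]
    refine div_le_div₀ (abs_nonneg _) (by rw [abs_sub_comm]; exact le_abs_self _) (by positivity) ?_
    have := min_le_left ϑ 1
    nlinarith [min_le_right ϑ 1]
  have h4 : (ϑ - 1) / (j + 1) ≤ |ϑ - 1| / min ϑ 1 / ((j : ℝ) + 1) := by
    refine div_le_div_of_nonneg_right ((le_abs_self _).trans ?_) (by positivity)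
    rw [le_div_iff₀ hm]
    exact mul_le_of_le_one_right (abs_nonneg _) (min_le_right _ _)
  constructor <;> linarith

lemma abs_exp_sub_one_le_mul_exp (y : ℝ) : |Real.exp y - 1| ≤ |y| * Real.exp |y| := by
  rw [abs_le]
  have h0 := Real.add_one_le_exp y
  have h1 := Real.add_one_le_exp (-y)
  have h2 : Real.exp y * Real.exp (-y) = 1 := by rw [← Real.exp_add]; simp
  have h3 := Real.exp_pos y
  have h4 : 1 ≤ Real.exp |y| := Real.one_le_exp (abs_nonneg y)
  have h5 : Real.exp y ≤ Real.exp |y| := Real.exp_le_exp.2 (le_abs_self y)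
  have h6 := neg_abs_le y
  have h7 := le_abs_self y
  constructor
  · nlinarith [abs_nonneg y]
  · have : Real.exp y - 1 ≤ y * Real.exp y := by nlinarith
    nlinarith [abs_nonneg y, mul_le_mul_of_nonneg_right h7 h3.le]

/-- The logarithm changes by `O(1/j)` per step, and the `b` steps involved all have `j ≥ i/2`, so
the total change is `O(b/i)`. -/
lemma exists_abs_ewensCoeff_ratio_sub_one_le (hϑ : 0 < ϑ) : ∃ C : ℝ, 0 < C ∧
    ∀ b i : ℕ, 2 * b ≤ i → |ewensCoeff ϑ (i - b) / ewensCoeff ϑ i - 1| ≤ C * (b / i) := by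
  set M := |ϑ - 1| / min ϑ 1 with hM
  have hM0 : 0 ≤ M := div_nonneg (abs_nonneg _) (lt_min hϑ one_pos).le
  refine ⟨2 * (M + 1) * Real.exp M, by positivity, fun b i hbi => ?_⟩
  rcases Nat.eq_zero_or_pos b with rfl | hb
  · simp [div_self (ewensCoeff_pos hϑ i).ne']
  have hi : 0 < i := by omega
  have hbi' : (2 : ℝ) * b ≤ i := by exact_mod_cast hbi
  have hi' : (0 : ℝ) < i := by exact_mod_cast hi
  have hb' : (0 : ℝ) < b := by exact_mod_cast hb
  set y := Real.log (ewensCoeff ϑ (i - b)) - Real.log (ewensCoeff ϑ i) with hy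
  have hratio : ewensCoeff ϑ (i - b) / ewensCoeff ϑ i = Real.exp y := by
    rw [hy, Real.exp_sub, Real.exp_log (ewensCoeff_pos hϑ _), Real.exp_log (ewensCoeff_pos hϑ _)]
  have hy1 : |y| ≤ 2 * M * (b / i) := by
    have h1 := dist_le_Ico_sum_of_dist_le (f := fun j => Real.log (ewensCoeff ϑ j))
      (m := i - b) (n := i) (by omega) (d := fun _ => M * (2 / i)) (fun {j} hj _ => by
        rw [Real.dist_eq]
        refine (abs_log_ewensCoeff_succ_sub_le hϑ j).trans ?_
        rw [← hM, div_eq_mul_inv]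
        refine mul_le_mul_of_nonneg_left ?_ hM0
        rw [inv_eq_one_div, div_le_div_iff₀ (by positivity) hi']
        have : (i : ℝ) ≤ j + b := by exact_mod_cast (by omega : i ≤ j + b)
        linarith)
    rw [Real.dist_eq, Finset.sum_const, Nat.card_Ico, show i - (i - b) = b by omega,
      nsmul_eq_mul] at h1
    refine h1.trans (le_of_eq ?_)
    ring
  have hbi2 : (b : ℝ) / i ≤ 1 / 2 := by rw [div_le_div_iff₀ hi' two_pos]; linarith
  have hy2 : |y| ≤ M := by nlinarith [mul_le_mul_of_nonneg_left hbi2 hM0]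
  rw [hratio]
  calc |Real.exp y - 1| ≤ |y| * Real.exp |y| := abs_exp_sub_one_le_mul_exp y
    _ ≤ (2 * M * (b / i)) * Real.exp M := by gcongr
    _ ≤ (2 * (M + 1) * (b / i)) * Real.exp M := by gcongr; linarith
    _ = _ := by ring

end Ewens

/-! ### The marked Ewens generating function. -/

/-- The weights `w` multiplied by `u` at the indices up to `b`. -/
noncomputable def markWeight (w : ℕ → ℝ) (u : ℂ) (b m : ℕ) : ℂ :=
  (if m ≤ b then u else 1) * w m

lemma norm_markWeight_le (w : ℕ → ℝ) {u : ℂ} (hu : ‖u‖ ≤ 1) (b m : ℕ) :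
    ‖markWeight w u b m‖ ≤ |w m| := by
  rw [markWeight, norm_mul, Complex.norm_real, Real.norm_eq_abs]
  refine mul_le_of_le_one_left (abs_nonneg _) ?_
  split_ifs
  · exact hu
  · simp

/-- The generating function of the number of cycles of length at most `b` under the Ewens measure
of parameter `ϑ` on `S_n`, evaluated at `u`. -/
noncomputable def ewensMarked (ϑ : ℝ) (u : ℂ) (b n : ℕ) : ℂ :=
  expCoeff (markWeight (fun _ => ϑ) u b) n / ewensCoeff ϑ n

section Ewens

variable {ϑ : ℝ}

lemma norm_expCoeff_markWeight_const_le (hϑ : 0 < ϑ) {u : ℂ} (hu : ‖u‖ ≤ 1) (b n : ℕ) :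
    ‖expCoeff (markWeight (fun _ => ϑ) u b) n‖ ≤ ewensCoeff ϑ n :=
  norm_expCoeff_le (fun m _ => (norm_markWeight_le _ hu b m).trans (abs_of_pos hϑ).le) n

lemma norm_ewensMarked_le_one (hϑ : 0 < ϑ) {u : ℂ} (hu : ‖u‖ ≤ 1) (b n : ℕ) :
    ‖ewensMarked ϑ u b n‖ ≤ 1 := by
  rw [ewensMarked, norm_div, Complex.norm_real, Real.norm_of_nonneg (ewensCoeff_pos hϑ n).le]
  exact div_le_one_of_le₀ (norm_expCoeff_markWeight_const_le hϑ hu b n) (ewensCoeff_pos hϑ n).le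

/-- No cycle can exceed `b`, so the weight is the constant `uϑ` and the quotient is one of rising
factorials. -/
lemma ewensMarked_of_le (hϑ : 0 < ϑ) (u : ℂ) {b n : ℕ} (h : n ≤ b) :
    ewensMarked ϑ u b n = ∏ j ∈ Finset.range n, (1 + ϑ * (u - 1) / (ϑ + j)) := by
  have h1 : expCoeff (markWeight (fun _ => ϑ) u b) n = expCoeff (fun _ => u * (ϑ : ℂ)) n :=
    expCoeff_congr fun m _ hm => by rw [markWeight, if_pos (by omega)]
  rw [ewensMarked, h1, ewensCoeff, expCoeff_const, expCoeff_const]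
  push_cast
  rw [← Finset.prod_div_distrib]
  refine Finset.prod_congr rfl fun j _ => ?_
  have hj : (ϑ : ℂ) + j ≠ 0 := by
    have : (0 : ℝ) < ϑ + j := by positivity
    exact_mod_cast this.ne'
  have hj' : (j : ℂ) + 1 ≠ 0 := Nat.cast_add_one_ne_zero j
  field_simp
  ring

lemma expCoeff_markWeight_const_succ (ϑ : ℝ) (u : ℂ) (b n : ℕ) :
    ((n : ℂ) + 1) * expCoeff (markWeight (fun _ => ϑ) u b) (n + 1) =
      ϑ * u * ∑ j ∈ Finset.range (n + 1), expCoeff (markWeight (fun _ => ϑ) u b) j +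
      ϑ * (1 - u) * ∑ j ∈ Finset.range (n + 1 - b),
        expCoeff (markWeight (fun _ => ϑ) u b) j := by
  set P := expCoeff (markWeight (fun _ => ϑ) u b) with hP
  have hr := Finset.sum_range_reflect
    (fun k => markWeight (fun _ => ϑ) u b (k + 1) * P (n - k)) (n + 1)
  simp only [Nat.add_sub_cancel] at hr
  have hsub : ∑ j ∈ Finset.range (n + 1 - b), P j =
      ∑ j ∈ Finset.range (n + 1), if j < n + 1 - b then P j else 0 := by
    rw [← Finset.sum_filter]
    refine Finset.sum_congr ?_ fun _ _ => rfl
    ext j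
    simp only [Finset.mem_range, Finset.mem_filter]
    omega
  rw [expCoeff_succ, ← hr, hsub, Finset.mul_sum, Finset.mul_sum, ← Finset.sum_add_distrib]
  refine Finset.sum_congr rfl fun j hj => ?_
  have hj := Finset.mem_range.1 hj
  rw [show n - (n - j) = j by omega, markWeight]
  by_cases hb : n - j + 1 ≤ b
  · rw [if_pos hb, if_neg (by omega)]
    ring
  · rw [if_neg hb, if_pos (by omega)]
    ring

/-- Two consecutive instances of the summed recurrence are subtracted; the partial sums collapse to
a delay equation with lag `b`. -/
lemma expCoeff_markWeight_const_succ_eq (ϑ : ℝ) (u : ℂ) (b n : ℕ) :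
    ((n : ℂ) + 1) * expCoeff (markWeight (fun _ => ϑ) u b) (n + 1) =
      (n + ϑ * u) * expCoeff (markWeight (fun _ => ϑ) u b) n +
      if b ≤ n then ϑ * (1 - u) * expCoeff (markWeight (fun _ => ϑ) u b) (n - b) else 0 := by
  have h1 := expCoeff_markWeight_const_succ ϑ u b n
  have hsub : ∑ j ∈ Finset.range (n + 1 - b), expCoeff (markWeight (fun _ => ϑ) u b) j =
      ∑ j ∈ Finset.range (n - b), expCoeff (markWeight (fun _ => ϑ) u b) j +
        if b ≤ n then expCoeff (markWeight (fun _ => ϑ) u b) (n - b) else 0 := by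
    split_ifs with hb
    · rw [show n + 1 - b = n - b + 1 by omega, Finset.sum_range_succ]
    · rw [show n + 1 - b = 0 by omega, show n - b = 0 by omega]
      simp
  have h2 : (n : ℂ) * expCoeff (markWeight (fun _ => ϑ) u b) n =
      ϑ * u * ∑ j ∈ Finset.range n, expCoeff (markWeight (fun _ => ϑ) u b) j +
      ϑ * (1 - u) * ∑ j ∈ Finset.range (n - b),
        expCoeff (markWeight (fun _ => ϑ) u b) j := by
    cases n with
    | zero => simp
    | succ n => rw [← expCoeff_markWeight_const_succ]; push_cast; ring
  rw [h1, hsub, Finset.sum_range_succ]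
  split_ifs <;> linear_combination -h2

lemma ewensMarked_succ_sub (hϑ : 0 < ϑ) (u : ℂ) (b n : ℕ) :
    ewensMarked ϑ u b (n + 1) - ewensMarked ϑ u b n = ϑ * (u - 1) / (n + ϑ) *
      (ewensMarked ϑ u b n -
        if b ≤ n then expCoeff (markWeight (fun _ => ϑ) u b) (n - b) / ewensCoeff ϑ n else 0) := by
  have h1 := expCoeff_markWeight_const_succ_eq ϑ u b n
  have h2 := congrArg Complex.ofReal (ewensCoeff_succ ϑ n)
  push_cast at h2
  have hp : (ewensCoeff ϑ n : ℂ) ≠ 0 := by exact_mod_cast (ewensCoeff_pos hϑ n).ne'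
  have hp' : (ewensCoeff ϑ (n + 1) : ℂ) ≠ 0 := by exact_mod_cast (ewensCoeff_pos hϑ (n + 1)).ne'
  have hn : (n : ℂ) + 1 ≠ 0 := Nat.cast_add_one_ne_zero n
  have hnϑ : (n : ℂ) + ϑ ≠ 0 := by
    have : (0 : ℝ) < n + ϑ := by positivity
    exact_mod_cast this.ne'
  have h3 : ewensMarked ϑ u b (n + 1) =
      (((n : ℂ) + 1) * expCoeff (markWeight (fun _ => ϑ) u b) (n + 1)) /
        ((n + ϑ) * ewensCoeff ϑ n) := by
    rw [← h2, ewensMarked, mul_div_mul_left _ _ hn]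
  rw [h3, h1, ewensMarked]
  split_ifs
  · field_simp
    ring
  · field_simp
    ring

lemma norm_ewensMarked_succ_sub_le (hϑ : 0 < ϑ) {u : ℂ} (hu : ‖u‖ ≤ 1) (b n : ℕ) :
    ‖ewensMarked ϑ u b (n + 1) - ewensMarked ϑ u b n‖ ≤ ϑ * ‖u - 1‖ / (n + ϑ) *
      (1 + if b ≤ n then ewensCoeff ϑ (n - b) / ewensCoeff ϑ n else 0) := by
  have hnϑ : ‖(n : ℂ) + ϑ‖ = n + ϑ := by
    rw [← Complex.ofReal_natCast, ← Complex.ofReal_add, Complex.norm_real,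
      Real.norm_of_nonneg (by positivity)]
  rw [ewensMarked_succ_sub hϑ, norm_mul, norm_div, norm_mul, hnϑ, Complex.norm_real,
    Real.norm_of_nonneg hϑ.le]
  gcongr
  refine (norm_sub_le _ _).trans (add_le_add (norm_ewensMarked_le_one hϑ hu b n) ?_)
  split_ifs
  · rw [norm_div, Complex.norm_real, Real.norm_of_nonneg (ewensCoeff_pos hϑ n).le]
    exact div_le_div_of_nonneg_right (norm_expCoeff_markWeight_const_le hϑ hu b _)
      (ewensCoeff_pos hϑ n).le
  · simp

/-- A crude bound with no decay in `n`, valid for every `n`; it pays for the finitely many steps by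
which `n - k` can fall below `b`. -/
lemma norm_ewensMarked_succ_sub_le_two_mul (hϑ : 0 < ϑ) {u : ℂ} (hu : ‖u‖ ≤ 1) (b n : ℕ) :
    ‖ewensMarked ϑ u b (n + 1) - ewensMarked ϑ u b n‖ ≤ 2 * ‖u - 1‖ := by
  refine (norm_ewensMarked_succ_sub_le hϑ hu b n).trans ?_
  have hnϑ : 0 < (n : ℝ) + ϑ := by positivity
  have h1 : ϑ / (n + ϑ) ≤ 1 := div_le_one_of_le₀ (by linarith [Nat.cast_nonneg (α := ℝ) n]) hnϑ.le
  have h2 : ϑ / (n + ϑ) * (if b ≤ n then ewensCoeff ϑ (n - b) / ewensCoeff ϑ n else 0) ≤ 1 := by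
    split_ifs
    · rw [div_mul_div_comm]
      exact div_le_one_of_le₀ (mul_ewensCoeff_le hϑ (Nat.sub_le n b))
        (mul_pos hnϑ (ewensCoeff_pos hϑ n)).le
    · simp
  calc ϑ * ‖u - 1‖ / (n + ϑ) *
        (1 + if b ≤ n then ewensCoeff ϑ (n - b) / ewensCoeff ϑ n else 0)
      = (ϑ / (n + ϑ) + ϑ / (n + ϑ) *
        (if b ≤ n then ewensCoeff ϑ (n - b) / ewensCoeff ϑ n else 0)) * ‖u - 1‖ := by ring
    _ ≤ 2 * ‖u - 1‖ := mul_le_mul_of_nonneg_right (by linarith) (norm_nonneg _)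

/-- Here the delayed index `n - b` starts at `0`, and for `ϑ < 1` single ratios of coefficients are
not bounded. Their sum is, by `mul_sum_ewensCoeff`: the undelayed terms contribute `ϑ` and the
delayed ones `1`. -/
lemma norm_ewensMarked_sub_le_of_le_two_mul (hϑ : 0 < ϑ) {u : ℂ} (hu : ‖u‖ ≤ 1) {b n : ℕ}
    (hb : b ≤ n) (hn : n ≤ 2 * b) :
    ‖ewensMarked ϑ u b n - ewensMarked ϑ u b b‖ ≤ (ϑ + 1) * ‖u - 1‖ := by
  have h1 := dist_le_Ico_sum_of_dist_le (f := ewensMarked ϑ u b) hb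
    (d := fun i => ‖u - 1‖ * (ϑ / (b + ϑ) + ϑ * ewensCoeff ϑ (i - b) /
      ((b + ϑ) * ewensCoeff ϑ b))) (fun {i} hi _ => by
      rw [dist_comm, dist_eq_norm]
      refine (norm_ewensMarked_succ_sub_le hϑ hu b i).trans ?_
      rw [if_pos hi]
      have hbi : (b : ℝ) ≤ i := by exact_mod_cast hi
      have hA : (b + ϑ) * ewensCoeff ϑ b ≤ (i + ϑ) * ewensCoeff ϑ i := by
        rw [← mul_sum_ewensCoeff, ← mul_sum_ewensCoeff]
        refine mul_le_mul_of_nonneg_left (Finset.sum_le_sum_of_subset_of_nonneg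
          (Finset.range_subset_range.2 (by omega)) fun j _ _ => (ewensCoeff_pos hϑ j).le) hϑ.le
      have hpb := ewensCoeff_pos hϑ b
      have hpi := ewensCoeff_pos hϑ (i - b)
      calc ϑ * ‖u - 1‖ / (i + ϑ) * (1 + ewensCoeff ϑ (i - b) / ewensCoeff ϑ i)
          = ‖u - 1‖ * (ϑ / (i + ϑ) +
            ϑ * ewensCoeff ϑ (i - b) / ((i + ϑ) * ewensCoeff ϑ i)) := by
            have := (ewensCoeff_pos hϑ i).ne'
            field_simp
        _ ≤ _ := by gcongr)
  rw [dist_comm, dist_eq_norm] at h1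
  refine h1.trans ?_
  rw [← Finset.mul_sum, mul_comm]
  refine mul_le_mul_of_nonneg_right ?_ (norm_nonneg _)
  rw [Finset.sum_add_distrib, Finset.sum_const, Nat.card_Ico, ← Finset.sum_div, ← Finset.mul_sum,
    nsmul_eq_mul]
  have hbϑ : 0 < (b : ℝ) + ϑ := by positivity
  refine add_le_add ?_ ?_
  · have : ((n - b : ℕ) : ℝ) ≤ b := by exact_mod_cast (by omega : n - b ≤ b)
    rw [mul_div_assoc', div_le_iff₀ hbϑ]
    nlinarith
  · refine div_le_one_of_le₀ ?_ (mul_pos hbϑ (ewensCoeff_pos hϑ b)).le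
    rw [← mul_sum_ewensCoeff, Finset.sum_Ico_eq_sum_range]
    refine mul_le_mul_of_nonneg_left ?_ hϑ.le
    simp only [Nat.add_sub_cancel_left]
    exact Finset.sum_le_sum_of_subset_of_nonneg
      (Finset.range_subset_range.2 (by omega)) fun j _ _ => (ewensCoeff_pos hϑ j).le

lemma exists_norm_ewensMarked_succ_sub_le (hϑ : 0 < ϑ) : ∃ C : ℝ, 0 < C ∧
    ∀ (u : ℂ), ‖u‖ ≤ 1 → ∀ b n : ℕ, 2 * b ≤ n →
      ‖ewensMarked ϑ u b (n + 1) - ewensMarked ϑ u b n‖ ≤ C * ‖u - 1‖ / (n + ϑ) := by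
  obtain ⟨C, hC, h⟩ := exists_abs_ewensCoeff_ratio_sub_one_le hϑ
  refine ⟨ϑ * (2 + C), by positivity, fun u hu b n hbn => ?_⟩
  refine (norm_ewensMarked_succ_sub_le hϑ hu b n).trans ?_
  rw [if_pos (by omega)]
  have h1 := (abs_le.1 (h b n hbn)).2
  have h2 : (b : ℝ) / n ≤ 1 :=
    div_le_one_of_le₀ (by exact_mod_cast (by omega : b ≤ n)) (Nat.cast_nonneg n)
  have h3 : 1 + ewensCoeff ϑ (n - b) / ewensCoeff ϑ n ≤ 2 + C := by nlinarith
  calc _ ≤ ϑ * ‖u - 1‖ / (n + ϑ) * (2 + C) := by gcongr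
    _ = _ := by ring

/-- Steps of size `1/n` alone would add up to a logarithm. For `n ≥ 3b` the undelayed and delayed
terms nearly cancel: they are `b` steps of size `O(1/n)` apart, and the change of normalization
costs another `O(b/n)`. The step is then of order `b/n²`, written in telescoping form. -/
lemma exists_norm_ewensMarked_succ_sub_le_sq (hϑ : 0 < ϑ) : ∃ C : ℝ, 0 < C ∧
    ∀ (u : ℂ), ‖u‖ ≤ 1 → ∀ b n : ℕ, 3 * b ≤ n → 0 < n →
      ‖ewensMarked ϑ u b (n + 1) - ewensMarked ϑ u b n‖ ≤ C * ‖u - 1‖ * (b / n - b / (n + 1)) := by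
  obtain ⟨C₁, hC₁, h₁⟩ := exists_norm_ewensMarked_succ_sub_le hϑ
  obtain ⟨C₂, hC₂, h₂⟩ := exists_abs_ewensCoeff_ratio_sub_one_le hϑ
  refine ⟨ϑ * (4 * C₁ + C₂) * 2, by positivity, fun u hu b n hbn hn => ?_⟩
  have hn' : (0 : ℝ) < n := by exact_mod_cast hn
  have hn1 : (1 : ℝ) ≤ n := by exact_mod_cast hn
  have hbn' : (3 : ℝ) * b ≤ n := by exact_mod_cast hbn
  have hb0 : (0 : ℝ) ≤ b := Nat.cast_nonneg b
  -- One factor `‖u - 1‖` already stands in front of the bracket; the second is discarded through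
  -- this bound.
  have hδ : ‖u - 1‖ ≤ 2 := (norm_sub_le _ _).trans (by rw [norm_one]; linarith)
  have h3 : ‖ewensMarked ϑ u b n - ewensMarked ϑ u b (n - b)‖ ≤ 4 * C₁ * (b / n) := by
    have h := dist_le_Ico_sum_of_dist_le (f := ewensMarked ϑ u b) (Nat.sub_le n b)
      (d := fun _ => 4 * C₁ * (1 / n)) (fun {i} hi _ => by
        rw [dist_comm, dist_eq_norm]
        refine (h₁ u hu b i (by omega)).trans ?_
        have hi' : (n : ℝ) ≤ i + b := by exact_mod_cast (by omega : n ≤ i + b)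
        have hiϑ : 0 < (i : ℝ) + ϑ := by positivity
        rw [mul_one_div, div_le_div_iff₀ hiϑ hn']
        have : (n : ℝ) ≤ 2 * (i + ϑ) := by linarith
        calc C₁ * ‖u - 1‖ * n ≤ C₁ * 2 * (2 * (i + ϑ)) := by gcongr
          _ = _ := by ring)
    rw [dist_comm, dist_eq_norm, Finset.sum_const, Nat.card_Ico,
      show n - (n - b) = b by omega, nsmul_eq_mul] at h
    refine h.trans (le_of_eq ?_)
    ring
  have hp := ewensCoeff_pos hϑ n
  have hpb := ewensCoeff_pos hϑ (n - b)
  have h4 : expCoeff (markWeight (fun _ => ϑ) u b) (n - b) / ewensCoeff ϑ n =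
      ewensMarked ϑ u b (n - b) + ewensMarked ϑ u b (n - b) *
        ((ewensCoeff ϑ (n - b) / ewensCoeff ϑ n - 1 : ℝ) : ℂ) := by
    have e1 : (ewensCoeff ϑ (n - b) : ℂ) ≠ 0 := by exact_mod_cast hpb.ne'
    have e2 : (ewensCoeff ϑ n : ℂ) ≠ 0 := by exact_mod_cast hp.ne'
    rw [ewensMarked]
    push_cast
    field_simp
    ring
  have hnϑ : ‖(n : ℂ) + ϑ‖ = n + ϑ := by
    rw [← Complex.ofReal_natCast, ← Complex.ofReal_add, Complex.norm_real,
      Real.norm_of_nonneg (by positivity)]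
  have h5 : ‖ewensMarked ϑ u b n - expCoeff (markWeight (fun _ => ϑ) u b) (n - b) /
      ewensCoeff ϑ n‖ ≤ (4 * C₁ + C₂) * (b / n) := by
    rw [h4, ← sub_sub]
    refine (norm_sub_le _ _).trans ?_
    rw [norm_mul, Complex.norm_real, Real.norm_eq_abs]
    have h6 := h₂ b n (by omega)
    have h7 := mul_le_mul (norm_ewensMarked_le_one hϑ hu b (n - b)) h6 (abs_nonneg _) zero_le_one
    linarith
  rw [ewensMarked_succ_sub hϑ, if_pos (by omega), norm_mul, norm_div, norm_mul, hnϑ,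
    Complex.norm_real, Real.norm_of_nonneg hϑ.le]
  have h8 : (b : ℝ) / n / n ≤ 2 * (b / n - b / (n + 1)) := by
    rw [div_sub_div _ _ hn'.ne' (by positivity), div_div, mul_div_assoc',
      div_le_div_iff₀ (by positivity) (by positivity)]
    have : (0 : ℝ) ≤ b * n * n * (n - 1) :=
      mul_nonneg (by positivity) (by linarith)
    nlinarith
  calc ϑ * ‖u - 1‖ / (n + ϑ) * ‖ewensMarked ϑ u b n -
        expCoeff (markWeight (fun _ => ϑ) u b) (n - b) / ewensCoeff ϑ n‖
      ≤ ϑ * ‖u - 1‖ / n * ((4 * C₁ + C₂) * (b / n)) := by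
        gcongr
        linarith
    _ = ϑ * (4 * C₁ + C₂) * ‖u - 1‖ * (b / n / n) := by ring
    _ ≤ ϑ * (4 * C₁ + C₂) * ‖u - 1‖ * (2 * (b / n - b / (n + 1))) := by gcongr
    _ = _ := by ring

/-- The ranges `[b, 2b]`, `[2b, 3b]` and `[3b, ∞)` each contribute `O(‖u - 1‖)`: by the summed delay
terms, by `b` steps of size `O(1/b)`, and by telescoping. -/
lemma exists_norm_ewensMarked_sub_le (hϑ : 0 < ϑ) : ∃ C : ℝ, 0 < C ∧
    ∀ (u : ℂ), ‖u‖ ≤ 1 → ∀ b n : ℕ, b ≤ n →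
      ‖ewensMarked ϑ u b n - ewensMarked ϑ u b b‖ ≤ C * ‖u - 1‖ := by
  obtain ⟨C₁, hC₁, h₁⟩ := exists_norm_ewensMarked_succ_sub_le hϑ
  obtain ⟨C₂, hC₂, h₂⟩ := exists_norm_ewensMarked_succ_sub_le_sq hϑ
  refine ⟨(ϑ + 1) + C₁ + C₂, by positivity, fun u hu b n hbn => ?_⟩
  have hδ := norm_nonneg (u - 1)
  rcases Nat.eq_zero_or_pos b with rfl | hb
  · have : ∀ k, ewensMarked ϑ u 0 k = 1 := by
      intro k
      have h1 : expCoeff (markWeight (fun _ => ϑ) u 0) k = (ewensCoeff ϑ k : ℂ) := by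
        rw [ewensCoeff, ← expCoeff_ofReal]
        exact expCoeff_congr fun m hm _ => by rw [markWeight, if_neg (by omega), one_mul]
      rw [ewensMarked, h1, div_self]
      exact_mod_cast (ewensCoeff_pos hϑ k).ne'
    rw [this, this, sub_self, norm_zero]
    positivity
  have hb' : (0 : ℝ) < b := by exact_mod_cast hb
  rcases le_total n (2 * b) with hn | hn
  · exact (norm_ewensMarked_sub_le_of_le_two_mul hϑ hu hbn hn).trans
      (mul_le_mul_of_nonneg_right (by linarith) hδ)
  have hA := norm_ewensMarked_sub_le_of_le_two_mul hϑ hu (b := b) (n := 2 * b) (by omega) le_rfl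
  have hB : ∀ k, 2 * b ≤ k → k ≤ 3 * b →
      ‖ewensMarked ϑ u b k - ewensMarked ϑ u b (2 * b)‖ ≤ C₁ * ‖u - 1‖ := by
    intro k hk hk3
    have h := dist_le_Ico_sum_of_dist_le (f := ewensMarked ϑ u b) hk
      (d := fun _ => C₁ * ‖u - 1‖ / b) (fun {i} hi _ => by
        rw [dist_comm, dist_eq_norm]
        refine (h₁ u hu b i hi).trans ?_
        have : (b : ℝ) ≤ i := by exact_mod_cast (by omega : b ≤ i)
        gcongr
        linarith)
    rw [dist_comm, dist_eq_norm, Finset.sum_const, Nat.card_Ico, nsmul_eq_mul] at h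
    refine h.trans ?_
    have : ((k - 2 * b : ℕ) : ℝ) ≤ b := by exact_mod_cast (by omega : k - 2 * b ≤ b)
    rw [mul_div_assoc', div_le_iff₀ hb', mul_comm]
    gcongr
  rcases le_total n (3 * b) with hn3 | hn3
  · have := norm_sub_le_norm_sub_add_norm_sub (ewensMarked ϑ u b n) (ewensMarked ϑ u b (2 * b))
      (ewensMarked ϑ u b b)
    nlinarith [hB n hn hn3, mul_nonneg hC₂.le hδ]
  have hC : ∀ k, 3 * b ≤ k → ‖ewensMarked ϑ u b k - ewensMarked ϑ u b (3 * b)‖ ≤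
      C₂ * ‖u - 1‖ * (b / (3 * b : ℕ) - b / k) := by
    intro k hk
    induction k, hk using Nat.le_induction with
    | base => simp
    | succ k hk ih =>
      have h := h₂ u hu b k hk (by omega)
      have ht := norm_sub_le_norm_sub_add_norm_sub (ewensMarked ϑ u b (k + 1))
        (ewensMarked ϑ u b k) (ewensMarked ϑ u b (3 * b))
      push_cast at ih ⊢
      linarith
  have h3 : C₂ * ‖u - 1‖ * (b / (3 * b : ℕ) - b / n) ≤ C₂ * ‖u - 1‖ := by
    refine mul_le_of_le_one_right (by positivity) ?_
    have : (b : ℝ) / (3 * b : ℕ) ≤ 1 :=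
      div_le_one_of_le₀ (by exact_mod_cast (by omega : b ≤ 3 * b)) (by positivity)
    have : (0 : ℝ) ≤ (b : ℝ) / n := by positivity
    linarith
  have t1 := norm_sub_le_norm_sub_add_norm_sub (ewensMarked ϑ u b n) (ewensMarked ϑ u b (3 * b))
    (ewensMarked ϑ u b b)
  have t2 := norm_sub_le_norm_sub_add_norm_sub (ewensMarked ϑ u b (3 * b))
    (ewensMarked ϑ u b (2 * b)) (ewensMarked ϑ u b b)
  linarith [hB (3 * b) (by omega) le_rfl, hC n hn3]

lemma exists_norm_ewensMarked_sub_prod_le (hϑ : 0 < ϑ) : ∃ C : ℝ, 0 < C ∧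
    ∀ (u : ℂ), ‖u‖ ≤ 1 → ∀ b n k : ℕ, b ≤ n →
      ‖ewensMarked ϑ u b (n - k) - ∏ j ∈ Finset.range b, (1 + ϑ * (u - 1) / (ϑ + j))‖ ≤
        (C + 2 * k) * ‖u - 1‖ := by
  obtain ⟨C, hC, h⟩ := exists_norm_ewensMarked_sub_le hϑ
  refine ⟨C, hC, fun u hu b n k hbn => ?_⟩
  rw [← ewensMarked_of_le hϑ u le_rfl]
  rcases le_total b (n - k) with hb | hb
  · refine (h u hu b _ hb).trans ?_
    gcongr
    linarith [Nat.cast_nonneg (α := ℝ) k]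
  · have h1 := dist_le_Ico_sum_of_dist_le (f := ewensMarked ϑ u b) hb
      (d := fun _ => 2 * ‖u - 1‖) (fun {i} _ _ => by
        rw [dist_comm, dist_eq_norm]
        exact norm_ewensMarked_succ_sub_le_two_mul hϑ hu b i)
    rw [dist_eq_norm, Finset.sum_const, Nat.card_Ico, nsmul_eq_mul] at h1
    refine h1.trans ?_
    have : ((b - (n - k) : ℕ) : ℝ) ≤ k := by exact_mod_cast (by omega : b - (n - k) ≤ k)
    nlinarith [norm_nonneg (u - 1), mul_nonneg hC.le (norm_nonneg (u - 1)),
      mul_le_mul_of_nonneg_right this (norm_nonneg (u - 1))]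

end Ewens

/-! ### From Ewens weights to perturbed weights. -/

section

variable {ϑ : ℝ}

lemma one_le_ratioBound (hϑ : 0 < ϑ) (k : ℕ) : 1 ≤ ratioBound ϑ k := by
  have hm : 0 < min ϑ 1 := lt_min hϑ one_pos
  induction k with
  | zero => rw [ratioBound_zero]
  | succ k ih =>
    rw [ratioBound_succ]
    refine one_le_mul_of_one_le_of_one_le ih ?_
    rw [le_div_iff₀ (by positivity)]
    linarith [min_le_right ϑ 1]

/-- With the growth factor absorbed into the weights, `ratioBound ϑ m * |ε m| / m` is `O(m^(-1 - min
ϑ 1))`, which is summable. -/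
lemma summable_expCoeff_mul_ratioBound (hϑ : 0 < ϑ) {ε : ℕ → ℝ} {C : ℝ}
    (hε : ∀ m : ℕ, 1 ≤ m → |ε m| ≤ C / m) :
    Summable fun k => ratioBound ϑ k * expCoeff (fun m => |ε m|) k := by
  have hm : 0 < min ϑ 1 := lt_min hϑ one_pos
  refine Summable.of_nonneg_of_le (fun k => mul_nonneg (ratioBound_pos hϑ k).le
    (expCoeff_nonneg (fun _ _ => abs_nonneg _) k))
    (fun k => mul_expCoeff_le (fun _ _ => abs_nonneg _) (ratioBound_zero ϑ)
      (fun m => (ratioBound_pos hϑ m).le) (ratioBound_add_le hϑ) k) ?_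
  refine summable_expCoeff (fun m _ => mul_nonneg (ratioBound_pos hϑ m).le (abs_nonneg _)) ?_
  have hs : Summable fun k : ℕ => (min ϑ 1)⁻¹ * C * ((k + 1 : ℕ) : ℝ) ^ (-1 - min ϑ 1) :=
    ((summable_nat_add_iff 1).2 (Real.summable_nat_rpow.2 (by linarith))).mul_left _
  refine Summable.of_nonneg_of_le (fun k => div_nonneg (mul_nonneg (ratioBound_pos hϑ _).le
    (abs_nonneg _)) (by positivity)) (fun k => ?_) hs
  have hk : (0 : ℝ) < (k : ℝ) + 1 := by positivity
  have h1 := hε (k + 1) (by omega)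
  push_cast at h1 ⊢
  have h2 : ((k : ℝ) + 1) ^ (-1 - min ϑ 1) =
      ((k : ℝ) + 1) ^ (1 - min ϑ 1) / (((k : ℝ) + 1) * ((k : ℝ) + 1)) := by
    rw [eq_div_iff (by positivity), ← sq, ← Real.rpow_natCast, ← Real.rpow_add hk]
    congr 1
    push_cast
    ring
  rw [h2]
  calc ratioBound ϑ (k + 1) * |ε (k + 1)| / (k + 1)
      ≤ ((min ϑ 1)⁻¹ * ((k : ℝ) + 1) ^ (1 - min ϑ 1)) * (C / (k + 1)) / (k + 1) := by
        gcongr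
        exact ratioBound_succ_le hϑ k
    _ = _ := by field_simp

lemma summable_expCoeff_abs (hϑ : 0 < ϑ) {ε : ℕ → ℝ} {C : ℝ}
    (hε : ∀ m : ℕ, 1 ≤ m → |ε m| ≤ C / m) :
    Summable fun k => expCoeff (fun m => |ε m|) k := by
  have h0 : ∀ k, 0 ≤ expCoeff (fun m => |ε m|) k := expCoeff_nonneg fun _ _ => abs_nonneg _
  exact Summable.of_nonneg_of_le h0
    (fun k => le_mul_of_one_le_left (h0 k) (one_le_ratioBound hϑ k))
    (summable_expCoeff_mul_ratioBound hϑ hε)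

lemma norm_prod_ewens_le_one (hϑ : 0 < ϑ) {u : ℂ} (hu : ‖u‖ ≤ 1) (b : ℕ) :
    ‖∏ j ∈ Finset.range b, (1 + ϑ * (u - 1) / (ϑ + j))‖ ≤ 1 := by
  rw [← ewensMarked_of_le hϑ u le_rfl]
  exact norm_ewensMarked_le_one hϑ hu b b

/-- Splitting `θ = (θ - ϑ) + ϑ` makes the coefficient a convolution. For fixed `k`, its `k`-th term
approaches `f₀ k * Q n`, and `ratioBound` dominates. The product `Q n` need not converge, so the
limit is stated for a difference. -/
theorem tendsto_expCoeff_markWeight_div_sub (hϑ : 0 < ϑ) {θ : ℕ → ℝ} {C : ℝ}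
    (hθ : ∀ m : ℕ, 1 ≤ m → |θ m - ϑ| ≤ C / m) {u : ℕ → ℂ} (hu : ∀ n, ‖u n‖ ≤ 1)
    (hu1 : Tendsto u atTop (𝓝 1)) {b : ℕ → ℕ} (hb : ∀ n, b n ≤ n) :
    Tendsto (fun n => expCoeff (markWeight θ (u n) (b n)) n / (ewensCoeff ϑ n : ℂ) -
      (∑' k, expCoeff (fun m => ((θ m - ϑ : ℝ) : ℂ)) k) *
        ∏ j ∈ Finset.range (b n), (1 + ϑ * (u n - 1) / (ϑ + j))) atTop (𝓝 0) := by
  obtain ⟨C', hC', hq⟩ := exists_norm_ewensMarked_sub_prod_le hϑ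
  set ε : ℕ → ℝ := fun m => θ m - ϑ with hε
  set f₀ : ℕ → ℂ := expCoeff fun m => (ε m : ℂ) with hf₀
  set f : ℕ → ℕ → ℂ := fun n => expCoeff (markWeight ε (u n) (b n)) with hf
  set Q : ℕ → ℂ := fun n => ∏ j ∈ Finset.range (b n), (1 + ϑ * (u n - 1) / (ϑ + j)) with hQ
  set fb : ℕ → ℝ := expCoeff fun m => |ε m| with hfb
  have hfle : ∀ n k, ‖f n k‖ ≤ fb k := fun n k =>
    norm_expCoeff_le (fun m _ => norm_markWeight_le ε (hu n) (b n) m) k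
  have hf0le : ∀ k, ‖f₀ k‖ ≤ fb k := fun k =>
    norm_expCoeff_le (fun m _ => by rw [Complex.norm_real, Real.norm_eq_abs]) k
  have hfb0 : ∀ k, 0 ≤ fb k := expCoeff_nonneg fun _ _ => abs_nonneg _
  have hsum1 : Summable fun k => ratioBound ϑ k * fb k := summable_expCoeff_mul_ratioBound hϑ hθ
  have hsum2 : Summable fb := summable_expCoeff_abs hϑ hθ
  have hsum0 : Summable f₀ := Summable.of_norm_bounded hsum2 hf0le
  have hQ1 : ∀ n, ‖Q n‖ ≤ 1 := fun n => norm_prod_ewens_le_one hϑ (hu n) (b n)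
  have hpc : ∀ n, (ewensCoeff ϑ n : ℂ) ≠ 0 := fun n => by exact_mod_cast (ewensCoeff_pos hϑ n).ne'
  -- The convolution divided by `ewensCoeff ϑ n`, with the Ewens factor at `n - k` renormalized and
  -- extended by `0` to all `k`.
  set T : ℕ → ℕ → ℂ := fun n k => if k ≤ n then f n k * (ewensMarked ϑ (u n) (b n) (n - k) *
    ((ewensCoeff ϑ (n - k) / ewensCoeff ϑ n : ℝ) : ℂ)) else 0 with hT
  have hconv : ∀ n, expCoeff (markWeight θ (u n) (b n)) n / (ewensCoeff ϑ n : ℂ) =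
      ∑' k, T n k := by
    intro n
    have h1 : markWeight θ (u n) (b n) = fun m =>
        markWeight ε (u n) (b n) m + markWeight (fun _ => ϑ) (u n) (b n) m := by
      funext m
      simp only [markWeight, hε]
      push_cast
      ring
    rw [tsum_eq_sum (s := Finset.range (n + 1)) fun k hk => if_neg (by
      simpa using hk), h1, expCoeff_add, Finset.sum_div]
    refine Finset.sum_congr rfl fun k hk => ?_
    rw [if_pos (by have := Finset.mem_range.1 hk; omega), ewensMarked]
    push_cast
    rw [div_mul_div_cancel₀ (hpc (n - k)), mul_div_assoc]
  have hTle : ∀ n k, ‖T n k‖ ≤ ratioBound ϑ k * fb k := by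
    intro n k
    simp only [hT]
    split_ifs with hk
    · rw [norm_mul, norm_mul, Complex.norm_real, Real.norm_of_nonneg
        (div_nonneg (ewensCoeff_pos hϑ _).le (ewensCoeff_pos hϑ _).le), mul_comm (ratioBound ϑ k)]
      refine mul_le_mul (hfle n k) ?_ (mul_nonneg (norm_nonneg _)
        (div_nonneg (ewensCoeff_pos hϑ _).le (ewensCoeff_pos hϑ _).le)) (hfb0 k)
      have h2 := ewensCoeff_le_ratioBound_mul hϑ (n - k) k
      rw [Nat.sub_add_cancel hk] at h2
      calc _ ≤ 1 * (ewensCoeff ϑ (n - k) / ewensCoeff ϑ n) :=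
            mul_le_mul_of_nonneg_right (norm_ewensMarked_le_one hϑ (hu n) _ _)
              (div_nonneg (ewensCoeff_pos hϑ _).le (ewensCoeff_pos hϑ _).le)
        _ ≤ ratioBound ϑ k := by
            rw [one_mul]
            exact (div_le_iff₀ (ewensCoeff_pos hϑ n)).2 h2
    · rw [norm_zero]
      exact mul_nonneg (ratioBound_pos hϑ k).le (hfb0 k)
  have hTsum : ∀ n, Summable (T n) := fun n => Summable.of_norm_bounded hsum1 (hTle n)
  have hdiff : ∀ n, expCoeff (markWeight θ (u n) (b n)) n / (ewensCoeff ϑ n : ℂ) -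
      (∑' k, f₀ k) * Q n = ∑' k, (T n k - f₀ k * Q n) := fun n => by
    rw [hconv, ← tsum_mul_right, (hTsum n).tsum_sub (hsum0.mul_right _)]
  have hu10 : Tendsto (fun n => ‖u n - 1‖) atTop (𝓝 0) := by
    rw [← tendsto_iff_norm_sub_tendsto_zero]
    exact hu1
  have hlim := tendsto_tsum_of_dominated_convergence (𝓕 := atTop)
    (f := fun n k => T n k - f₀ k * Q n) (g := fun _ => (0 : ℂ))
    (bound := fun k => ratioBound ϑ k * fb k + fb k) (hsum1.add hsum2) (fun k => ?_)
    (Eventually.of_forall fun n k => (norm_sub_le _ _).trans (add_le_add (hTle n k) ?_))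
  · rw [tsum_zero] at hlim
    exact hlim.congr fun n => (hdiff n).symm
  · have hfk : Tendsto (fun n => f n k) atTop (𝓝 (f₀ k)) := by
      refine tendsto_expCoeff (fun m _ => ?_) k
      have h1 : Tendsto (fun n => if m ≤ b n then u n else 1) atTop (𝓝 (1 : ℂ)) := by
        rw [tendsto_iff_norm_sub_tendsto_zero]
        refine squeeze_zero (fun _ => norm_nonneg _) (fun n => ?_) hu10
        split_ifs
        · exact le_rfl
        · simp
      simpa [markWeight] using h1.mul_const (ε m : ℂ)
    have hr : Tendsto (fun n => ((ewensCoeff ϑ (n - k) / ewensCoeff ϑ n : ℝ) : ℂ)) atTop (𝓝 1) := by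
      rw [← Complex.ofReal_one]
      exact (Complex.continuous_ofReal.tendsto 1).comp (tendsto_ewensCoeff_ratio hϑ k)
    have hqQ : Tendsto (fun n => ewensMarked ϑ (u n) (b n) (n - k) - Q n) atTop (𝓝 0) := by
      rw [tendsto_zero_iff_norm_tendsto_zero]
      refine squeeze_zero (fun _ => norm_nonneg _) (fun n => hq (u n) (hu n) (b n) n k (hb n)) ?_
      simpa using hu10.const_mul (C' + 2 * k)
    have hA : Tendsto (fun n => f n k * ((ewensCoeff ϑ (n - k) / ewensCoeff ϑ n : ℝ) : ℂ) - f₀ k)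
        atTop (𝓝 0) := by
      have := (hfk.mul hr).sub_const (f₀ k)
      simpa using this
    have hB : Tendsto (fun n => (f n k * ((ewensCoeff ϑ (n - k) / ewensCoeff ϑ n : ℝ) : ℂ)) *
        (ewensMarked ϑ (u n) (b n) (n - k) - Q n)) atTop (𝓝 0) := by
      simpa using (hfk.mul hr).mul hqQ
    have hD : Tendsto (fun n => (f n k * ((ewensCoeff ϑ (n - k) / ewensCoeff ϑ n : ℝ) : ℂ) - f₀ k) *
        Q n) atTop (𝓝 0) := by
      rw [tendsto_zero_iff_norm_tendsto_zero] at hA ⊢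
      refine squeeze_zero (fun _ => norm_nonneg _) (fun n => ?_) hA
      rw [norm_mul]
      exact mul_le_of_le_one_right (norm_nonneg _) (hQ1 n)
    have hBD := hB.add hD
    rw [add_zero] at hBD
    refine hBD.congr' ?_
    filter_upwards [eventually_ge_atTop k] with n hn
    simp only [hT]
    rw [if_pos hn]
    ring
  · rw [norm_mul]
    exact (mul_le_of_le_one_right (norm_nonneg _) (hQ1 n)).trans (hf0le k)

lemma tsum_expCoeff_sub_ne_zero {θ : ℕ → ℝ} {C : ℝ}
    (hθ : ∀ m : ℕ, 1 ≤ m → |θ m - ϑ| ≤ C / m) :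
    ∑' k, expCoeff (fun m => ((θ m - ϑ : ℝ) : ℂ)) k ≠ 0 := by
  refine tsum_expCoeff_ne_zero ?_
  have hs : Summable fun k : ℕ => C * (1 / ((k + 1 : ℕ) : ℝ) ^ 2) :=
    ((summable_nat_add_iff 1).2 (Real.summable_one_div_nat_pow.2 one_lt_two)).mul_left _
  refine Summable.of_nonneg_of_le (fun k => by positivity) (fun k => ?_) hs
  have h := hθ (k + 1) (by omega)
  rw [Complex.norm_real, Real.norm_eq_abs]
  push_cast at h ⊢
  calc |θ (k + 1) - ϑ| / ((k : ℝ) + 1) ≤ C / (k + 1) / (k + 1) := by gcongr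
    _ = _ := by field_simp

/-- The case of no marking, `u = 1` and `b = 0`, where the product is empty. -/
theorem tendsto_expCoeff_div_ewensCoeff (hϑ : 0 < ϑ) {θ : ℕ → ℝ} {C : ℝ}
    (hθ : ∀ m : ℕ, 1 ≤ m → |θ m - ϑ| ≤ C / m) :
    Tendsto (fun n => ((expCoeff θ n / ewensCoeff ϑ n : ℝ) : ℂ)) atTop
      (𝓝 (∑' k, expCoeff (fun m => ((θ m - ϑ : ℝ) : ℂ)) k)) := by
  have h := tendsto_expCoeff_markWeight_div_sub hϑ hθ (u := fun _ => 1) (b := fun _ => 0)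
    (fun _ => by simp) tendsto_const_nhds (fun _ => Nat.zero_le _)
  have h2 := h.add_const (∑' k, expCoeff (fun m => ((θ m - ϑ : ℝ) : ℂ)) k)
  rw [zero_add] at h2
  refine h2.congr fun n => ?_
  have h3 : markWeight θ 1 0 = fun m => (θ m : ℂ) := by
    funext m
    simp [markWeight]
  rw [h3, expCoeff_ofReal]
  simp

theorem eventually_expCoeff_pos (hϑ : 0 < ϑ) {θ : ℕ → ℝ} (hθ0 : ∀ m, 1 ≤ m → 0 ≤ θ m) {C : ℝ}
    (hθ : ∀ m : ℕ, 1 ≤ m → |θ m - ϑ| ≤ C / m) : ∀ᶠ n in atTop, 0 < expCoeff θ n := by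
  filter_upwards [(tendsto_expCoeff_div_ewensCoeff hϑ hθ).eventually_ne
    (tsum_expCoeff_sub_ne_zero hθ)] with n hn
  refine (expCoeff_nonneg hθ0 n).lt_of_ne fun h => hn ?_
  rw [← h]
  simp

theorem tendsto_expCoeff_markWeight_div_expCoeff_sub (hϑ : 0 < ϑ) {θ : ℕ → ℝ} {C : ℝ}
    (hθ : ∀ m : ℕ, 1 ≤ m → |θ m - ϑ| ≤ C / m) {u : ℕ → ℂ} (hu : ∀ n, ‖u n‖ ≤ 1)
    (hu1 : Tendsto u atTop (𝓝 1)) {b : ℕ → ℕ} (hb : ∀ n, b n ≤ n) :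
    Tendsto (fun n => expCoeff (markWeight θ (u n) (b n)) n / ((expCoeff θ n : ℝ) : ℂ) -
        ∏ j ∈ Finset.range (b n), (1 + ϑ * (u n - 1) / (ϑ + j))) atTop (𝓝 0) := by
  have h1 := tendsto_expCoeff_markWeight_div_sub hϑ hθ hu hu1 hb
  have h2 := tendsto_expCoeff_div_ewensCoeff hϑ hθ
  have hF := tsum_expCoeff_sub_ne_zero hθ
  set Fs := ∑' k, expCoeff (fun m => ((θ m - ϑ : ℝ) : ℂ)) k
  set Q : ℕ → ℂ := fun n => ∏ j ∈ Finset.range (b n), (1 + ϑ * (u n - 1) / (ϑ + j)) with hQ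
  have h3 : Tendsto (fun n => (Fs - ((expCoeff θ n / ewensCoeff ϑ n : ℝ) : ℂ)) * Q n)
      atTop (𝓝 0) := by
    have h4 := h2.const_sub Fs
    rw [sub_self, tendsto_zero_iff_norm_tendsto_zero] at h4
    rw [tendsto_zero_iff_norm_tendsto_zero]
    refine squeeze_zero (fun _ => norm_nonneg _) (fun n => ?_) h4
    rw [norm_mul]
    exact mul_le_of_le_one_right (norm_nonneg _) (norm_prod_ewens_le_one hϑ (hu n) (b n))
  have h5 := (h1.add h3).div h2 hF
  rw [add_zero, zero_div] at h5
  refine h5.congr' ?_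
  filter_upwards [h2.eventually_ne hF] with n hn
  have hpc : (ewensCoeff ϑ n : ℂ) ≠ 0 := by exact_mod_cast (ewensCoeff_pos hϑ n).ne'
  push_cast at hn
  have hθn : ((expCoeff θ n : ℝ) : ℂ) ≠ 0 := (div_ne_zero_iff.1 hn).1
  simp only [Pi.div_apply]
  push_cast
  rw [show ∏ j ∈ Finset.range (b n), (1 + ϑ * (u n - 1) / (ϑ + j)) = Q n from rfl]
  field_simp
  ring

end

/-! ### Gaussian asymptotics of the Ewens product. -/

section

variable {ϑ : ℝ}

/-- With `min ϑ 1` in the second factor, the bound covers both the comparison with the harmonic sum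
and the quadratic error of the logarithm. -/
lemma sum_one_div_add_mul_le (hϑ : 0 < ϑ) : ∃ C : ℝ, 0 < C ∧ ∀ b : ℕ,
    ∑ j ∈ Finset.range b, (1 / (ϑ + j)) * (1 / (min ϑ 1 + j)) ≤ C := by
  have hm : 0 < min ϑ 1 := lt_min hϑ one_pos
  have hs : Summable fun k : ℕ => ((min ϑ 1)⁻¹ * (min ϑ 1)⁻¹) * (1 / ((k + 1 : ℕ) : ℝ) ^ 2) :=
    ((summable_nat_add_iff 1).2 (Real.summable_one_div_nat_pow.2 one_lt_two)).mul_left _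
  refine ⟨∑' k : ℕ, ((min ϑ 1)⁻¹ * (min ϑ 1)⁻¹) * (1 / ((k + 1 : ℕ) : ℝ) ^ 2) + 1,
    add_pos_of_nonneg_of_pos (tsum_nonneg fun k => by positivity) one_pos, fun b => ?_⟩
  refine le_trans ?_ (le_add_of_nonneg_right zero_le_one)
  refine le_trans (Finset.sum_le_sum fun j _ => ?_)
    (hs.sum_le_tsum (Finset.range b) fun k _ => by positivity)
  have hj : (0 : ℝ) ≤ j := Nat.cast_nonneg j
  have h1 : min ϑ 1 * ((j : ℝ) + 1) ≤ min ϑ 1 + j := by nlinarith [min_le_right ϑ 1]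
  have h2 : min ϑ 1 * ((j : ℝ) + 1) ≤ ϑ + j := h1.trans (by linarith [min_le_left ϑ 1])
  have h3 : 0 < min ϑ 1 * ((j : ℝ) + 1) := by positivity
  calc (1 / (ϑ + j)) * (1 / (min ϑ 1 + j))
      ≤ (1 / (min ϑ 1 * ((j : ℝ) + 1))) * (1 / (min ϑ 1 * ((j : ℝ) + 1))) := by gcongr
    _ = _ := by push_cast; field_simp

lemma exists_abs_sum_one_div_add_sub_log_le (hϑ : 0 < ϑ) : ∃ C : ℝ, 0 < C ∧ ∀ b : ℕ, 1 ≤ b →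
    |∑ j ∈ Finset.range b, 1 / (ϑ + (j : ℝ)) - Real.log b| ≤ C := by
  obtain ⟨C, hC, h⟩ := sum_one_div_add_mul_le hϑ
  have hm : 0 < min ϑ 1 := lt_min hϑ one_pos
  refine ⟨|1 - ϑ| * C + 1, by positivity, fun b hb => ?_⟩
  have hh : ((harmonic b : ℚ) : ℝ) = ∑ j ∈ Finset.range b, 1 / ((j : ℝ) + 1) := by
    rw [harmonic]
    push_cast
    simp
  have hb' : (0 : ℝ) < b := by exact_mod_cast hb
  have h1 : Real.log b ≤ ((harmonic b : ℚ) : ℝ) := (Real.log_le_log hb' (by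
    push_cast; linarith)).trans (log_add_one_le_harmonic b)
  have h2 := harmonic_le_one_add_log b
  have h3 : |∑ j ∈ Finset.range b, 1 / (ϑ + (j : ℝ)) - ((harmonic b : ℚ) : ℝ)| ≤ |1 - ϑ| * C := by
    rw [hh, ← Finset.sum_sub_distrib]
    refine (Finset.abs_sum_le_sum_abs _ _).trans ?_
    refine le_trans ?_ (mul_le_mul_of_nonneg_left (h b) (abs_nonneg _))
    rw [Finset.mul_sum]
    refine Finset.sum_le_sum fun j _ => ?_
    have hj : (0 : ℝ) < (j : ℝ) + 1 := by positivity
    have hjϑ : 0 < ϑ + (j : ℝ) := by positivity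
    have h4 : 1 / (ϑ + (j : ℝ)) - 1 / ((j : ℝ) + 1) =
        (1 - ϑ) * (1 / (ϑ + j) * (1 / ((j : ℝ) + 1))) := by
      field_simp
      ring
    rw [h4, abs_mul, abs_of_pos (a := 1 / (ϑ + (j : ℝ)) * (1 / ((j : ℝ) + 1))) (by positivity)]
    have h5 : 1 / ((j : ℝ) + 1) ≤ 1 / (min ϑ 1 + j) :=
      one_div_le_one_div_of_le (by positivity) (by linarith [min_le_right ϑ 1])
    gcongr
  rw [abs_le] at h3 ⊢
  constructor <;> linarith

lemma abs_log_floor_rpow_sub_le {x : ℝ} (hx : 0 ≤ x) {n : ℕ} (hn : 1 ≤ n) :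
    1 ≤ ⌊(n : ℝ) ^ x⌋₊ ∧ |Real.log ⌊(n : ℝ) ^ x⌋₊ - x * Real.log n| ≤ Real.log 2 := by
  have hn1 : (1 : ℝ) ≤ n := by exact_mod_cast hn
  have h1 : 1 ≤ (n : ℝ) ^ x := Real.one_le_rpow hn1 hx
  have hfl : 1 ≤ ⌊(n : ℝ) ^ x⌋₊ := Nat.le_floor (by simpa using h1)
  have hfl' : (1 : ℝ) ≤ ⌊(n : ℝ) ^ x⌋₊ := by exact_mod_cast hfl
  have h2 := Nat.floor_le (zero_le_one.trans h1)
  have h3 := Nat.lt_floor_add_one ((n : ℝ) ^ x)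
  have h4 : Real.log ((n : ℝ) ^ x) = x * Real.log n := Real.log_rpow (by linarith) x
  have h5 := Real.log_le_log (by linarith) h2
  have h6 : Real.log ((n : ℝ) ^ x) ≤ Real.log (2 * ⌊(n : ℝ) ^ x⌋₊) :=
    Real.log_le_log (by linarith) (by linarith)
  rw [Real.log_mul (by norm_num) (by linarith)] at h6
  refine ⟨hfl, abs_le.2 ⟨by linarith, ?_⟩⟩
  linarith [Real.log_pos one_lt_two]

lemma norm_sum_log_sub_le (hϑ : 0 < ϑ) : ∃ C : ℝ, 0 < C ∧ ∀ (z : ℂ), ‖z‖ ≤ min ϑ 1 / 2 → ∀ b : ℕ,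
    ‖∑ j ∈ Finset.range b, Complex.log (1 + z / (ϑ + j)) -
      z * ((∑ j ∈ Finset.range b, 1 / (ϑ + (j : ℝ)) : ℝ) : ℂ)‖ ≤ C * ‖z‖ ^ 2 := by
  obtain ⟨C, hC, h⟩ := sum_one_div_add_mul_le hϑ
  have hm : 0 < min ϑ 1 := lt_min hϑ one_pos
  refine ⟨C, hC, fun z hz b => ?_⟩
  have h1 : z * ((∑ j ∈ Finset.range b, 1 / (ϑ + (j : ℝ)) : ℝ) : ℂ) =
      ∑ j ∈ Finset.range b, z / (ϑ + j) := by
    push_cast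
    rw [Finset.mul_sum]
    simp [div_eq_mul_inv]
  rw [h1, ← Finset.sum_sub_distrib]
  refine (norm_sum_le _ _).trans ?_
  refine le_trans ?_ (mul_le_mul_of_nonneg_right (h b) (sq_nonneg ‖z‖))
  rw [Finset.sum_mul]
  refine Finset.sum_le_sum fun j _ => ?_
  have hjϑ : 0 < ϑ + (j : ℝ) := by positivity
  have hjm : 0 < min ϑ 1 + (j : ℝ) := by positivity
  have hle : min ϑ 1 + (j : ℝ) ≤ ϑ + j := by linarith [min_le_left ϑ 1]
  have hnorm : ‖z / ((ϑ : ℂ) + j)‖ = ‖z‖ / (ϑ + j) := by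
    rw [norm_div, ← Complex.ofReal_natCast, ← Complex.ofReal_add, Complex.norm_real,
      Real.norm_of_nonneg hjϑ.le]
  have hhalf : ‖z / ((ϑ : ℂ) + j)‖ ≤ 1 / 2 := by
    rw [hnorm, div_le_div_iff₀ hjϑ two_pos]
    linarith [min_le_left ϑ 1, Nat.cast_nonneg (α := ℝ) j]
  have h2 := Complex.norm_log_one_add_sub_self_le (hhalf.trans_lt (by norm_num))
  refine h2.trans ?_
  have h3 : (1 - ‖z / ((ϑ : ℂ) + j)‖)⁻¹ ≤ 2 := by
    rw [inv_le_comm₀ (by linarith) two_pos]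
    linarith
  calc ‖z / ((ϑ : ℂ) + j)‖ ^ 2 * (1 - ‖z / ((ϑ : ℂ) + j)‖)⁻¹ / 2
      ≤ ‖z / ((ϑ : ℂ) + j)‖ ^ 2 * 2 / 2 := by gcongr
    _ = (1 / (ϑ + j)) * (1 / (ϑ + j)) * ‖z‖ ^ 2 := by rw [hnorm]; field_simp
    _ ≤ _ := by gcongr

lemma tendsto_sq_mul_exp_sub {ι : Type*} {l : Filter ι} {s : ι → ℝ} (hs : Tendsto s l atTop)
    (t : ℝ) : Tendsto (fun i => (s i : ℂ) ^ 2 * (Complex.exp ((t / s i : ℝ) * Complex.I) - 1) -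
      Complex.I * t * s i) l (𝓝 (-(t : ℂ) ^ 2 / 2)) := by
  have h0 : Tendsto (fun i => t / s i) l (𝓝 0) := tendsto_const_nhds.div_atTop hs
  -- The constant is the one in `Complex.exp_bound` for the third-order Taylor remainder.
  have h1 : Tendsto (fun i => |t| ^ 3 * (4 * (6 * 3 : ℝ)⁻¹) / s i) l (𝓝 0) :=
    tendsto_const_nhds.div_atTop hs
  rw [tendsto_iff_norm_sub_tendsto_zero]
  refine squeeze_zero' (Eventually.of_forall fun _ => norm_nonneg _) ?_ h1
  have h0' : ∀ᶠ i in l, |t / s i| < 1 := by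
    have := h0.abs
    rw [abs_zero] at this
    exact this.eventually_lt_const one_pos
  filter_upwards [hs.eventually_gt_atTop 0, h0'] with i hi hti
  have hsi : (s i : ℂ) ≠ 0 := by exact_mod_cast hi.ne'
  have hnorm : ‖((t / s i : ℝ) : ℂ) * Complex.I‖ = |t| / s i := by
    rw [norm_mul, Complex.norm_I, mul_one, Complex.norm_real, Real.norm_eq_abs, abs_div,
      abs_of_pos hi]
  have hle1 : ‖((t / s i : ℝ) : ℂ) * Complex.I‖ ≤ 1 := by
    rw [hnorm]
    rw [abs_div, abs_of_pos hi] at hti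
    exact hti.le
  have hb := Complex.exp_bound hle1 (n := 3) (by norm_num)
  have heq : (s i : ℂ) ^ 2 * (Complex.exp ((t / s i : ℝ) * Complex.I) - 1) -
      Complex.I * t * s i - -(t : ℂ) ^ 2 / 2 = (s i : ℂ) ^ 2 *
      (Complex.exp ((t / s i : ℝ) * Complex.I) -
        ∑ m ∈ Finset.range 3, (((t / s i : ℝ) : ℂ) * Complex.I) ^ m / (m ! : ℂ)) := by
    simp only [Finset.sum_range_succ, Finset.sum_range_zero]
    push_cast
    field_simp
    simp [Nat.factorial]
    ring
  rw [heq, norm_mul, norm_pow, Complex.norm_real, Real.norm_of_nonneg hi.le]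
  rw [hnorm] at hb
  calc s i ^ 2 * _ ≤ s i ^ 2 * ((|t| / s i) ^ 3 * (((Nat.succ 3 : ℕ) : ℝ) *
        ((3 ! : ℕ) * (3 : ℕ) : ℝ)⁻¹)) := by gcongr
    _ = _ := by
      norm_num [Nat.factorial]
      field_simp

/-- The logarithm of the product is `z S + O(|z|²)` with `S = x log n + O(1)` and `z → 0`. The main
term `z x log n` equals `x s² (exp(it/s) - 1)` for `s² = ϑ log n`, and the exponential factor
removes its divergent part `i t x s`. -/
theorem tendsto_prod_ewens_mul_exp (hϑ : 0 < ϑ) {x : ℝ} (hx : 0 ≤ x) (t : ℝ) :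
    Tendsto (fun n : ℕ => (∏ j ∈ Finset.range ⌊(n : ℝ) ^ x⌋₊, (1 + ϑ *
        (Complex.exp ((t / √(ϑ * Real.log n) : ℝ) * Complex.I) - 1) / (ϑ + j))) *
      Complex.exp (-(Complex.I * t * x * √(ϑ * Real.log n)))) atTop
      (𝓝 (Complex.exp (-(x * (t : ℂ) ^ 2 / 2)))) := by
  obtain ⟨C₁, hC₁, h₁⟩ := norm_sum_log_sub_le hϑ
  obtain ⟨C₂, hC₂, h₂⟩ := exists_abs_sum_one_div_add_sub_log_le hϑ
  have hm : 0 < min ϑ 1 := lt_min hϑ one_pos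
  set s : ℕ → ℝ := fun n => √(ϑ * Real.log n) with hs
  set z : ℕ → ℂ := fun n => ϑ * (Complex.exp ((t / s n : ℝ) * Complex.I) - 1) with hz
  set b : ℕ → ℕ := fun n => ⌊(n : ℝ) ^ x⌋₊ with hb
  set S : ℕ → ℝ := fun n => ∑ j ∈ Finset.range (b n), 1 / (ϑ + (j : ℝ)) with hS
  have hsT : Tendsto s atTop atTop := Real.tendsto_sqrt_atTop.comp
    ((Real.tendsto_log_atTop.comp tendsto_natCast_atTop_atTop).const_mul_atTop hϑ)
  have hzT : Tendsto z atTop (𝓝 0) := by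
    have h0 : Tendsto (fun n => t / s n) atTop (𝓝 0) := tendsto_const_nhds.div_atTop hsT
    have hc : Continuous fun y : ℝ => (ϑ : ℂ) * (Complex.exp ((y : ℂ) * Complex.I) - 1) := by
      fun_prop
    have h := (hc.tendsto 0).comp h0
    simp only [Complex.ofReal_zero, zero_mul, Complex.exp_zero, sub_self, mul_zero] at h
    exact h
  have hzT' : Tendsto (fun n => ‖z n‖) atTop (𝓝 0) := by simpa using hzT.norm
  have hE1 : Tendsto (fun n => ∑ j ∈ Finset.range (b n), Complex.log (1 + z n / (ϑ + j)) -
      z n * (S n : ℂ)) atTop (𝓝 0) := by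
    rw [tendsto_zero_iff_norm_tendsto_zero]
    refine squeeze_zero' (Eventually.of_forall fun _ => norm_nonneg _) ?_
      (by simpa using (hzT'.pow 2).const_mul C₁ :
        Tendsto (fun n => C₁ * ‖z n‖ ^ 2) atTop (𝓝 0))
    filter_upwards [hzT'.eventually_lt_const (half_pos hm)] with n hn
    exact h₁ (z n) hn.le (b n)
  have hE2 : Tendsto (fun n => z n * ((S n - x * Real.log n : ℝ) : ℂ)) atTop (𝓝 0) := by
    rw [tendsto_zero_iff_norm_tendsto_zero]
    refine squeeze_zero' (Eventually.of_forall fun _ => norm_nonneg _) ?_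
      (by simpa using hzT'.mul_const (C₂ + Real.log 2) :
        Tendsto (fun n => ‖z n‖ * (C₂ + Real.log 2)) atTop (𝓝 0))
    filter_upwards [eventually_ge_atTop 1] with n hn
    obtain ⟨h3, h4⟩ := abs_log_floor_rpow_sub_le hx hn
    have h5 := h₂ (b n) h3
    rw [norm_mul, Complex.norm_real, Real.norm_eq_abs]
    refine mul_le_mul_of_nonneg_left ?_ (norm_nonneg _)
    exact (abs_sub_le _ (Real.log (b n)) _).trans (add_le_add h5 h4)
  have hE3 := ((tendsto_sq_mul_exp_sub hsT t).const_mul (x : ℂ))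
  have hsum := (hE1.add hE2).add hE3
  have hexp := (Complex.continuous_exp.tendsto _).comp hsum
  have hlim : (0 : ℂ) + 0 + x * (-(t : ℂ) ^ 2 / 2) = -(x * (t : ℂ) ^ 2 / 2) := by ring
  rw [hlim] at hexp
  refine hexp.congr' ?_
  filter_upwards [hzT'.eventually_lt_const (half_pos hm), eventually_ge_atTop 1] with n hn hn1
  have hlog : 0 ≤ ϑ * Real.log n :=
    mul_nonneg hϑ.le (Real.log_nonneg (by exact_mod_cast hn1))
  have hsq : (s n : ℂ) ^ 2 = ϑ * Real.log n := by
    rw [← Complex.ofReal_pow, hs, Real.sq_sqrt hlog, Complex.ofReal_mul]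
  have hprod : ∏ j ∈ Finset.range (b n), (1 + z n / (ϑ + j)) =
      Complex.exp (∑ j ∈ Finset.range (b n), Complex.log (1 + z n / (ϑ + j))) := by
    rw [Complex.exp_sum]
    refine Finset.prod_congr rfl fun j _ => (Complex.exp_log fun h0 => ?_).symm
    have hjϑ : 0 < ϑ + (j : ℝ) := by positivity
    have h6 : ‖z n / ((ϑ : ℂ) + j)‖ = 1 := by
      rw [eq_neg_of_add_eq_zero_right h0, norm_neg, norm_one]
    rw [norm_div, ← Complex.ofReal_natCast, ← Complex.ofReal_add, Complex.norm_real,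
      Real.norm_of_nonneg hjϑ.le, div_eq_one_iff_eq hjϑ.ne'] at h6
    linarith [min_le_left ϑ 1, Nat.cast_nonneg (α := ℝ) j]
  have hgoal : (∏ j ∈ Finset.range ⌊(n : ℝ) ^ x⌋₊, (1 + ϑ *
        (Complex.exp ((t / √(ϑ * Real.log n) : ℝ) * Complex.I) - 1) / (ϑ + j))) =
      ∏ j ∈ Finset.range (b n), (1 + z n / (ϑ + j)) := rfl
  rw [hgoal, hprod, ← Complex.exp_add, Function.comp_apply]
  congr 1
  rw [hsq, Complex.ofReal_sub, Complex.ofReal_mul x, show √(ϑ * Real.log n) = s n from rfl]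
  simp only [hz]
  ring

end

/-! ### Characteristic functions and convergence in distribution. -/

lemma prod_map_markWeight (θ : ℕ → ℝ) (u : ℂ) (b : ℕ) (s : Multiset ℕ) (hs : ∀ i ∈ s, 0 < i) :
    (s.map (markWeight θ u b)).prod =
      u ^ (∑ m ∈ Finset.Icc 1 b, s.count m) * (((s.map θ).prod : ℝ) : ℂ) := by
  induction s using Multiset.induction_on with
  | empty => simp
  | cons a s ih =>
    have ha : 0 < a := hs a (Multiset.mem_cons_self a s)
    have hsum : ∑ m ∈ Finset.Icc 1 b, (a ::ₘ s).count m =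
        ∑ m ∈ Finset.Icc 1 b, s.count m + if a ≤ b then 1 else 0 := by
      simp only [Multiset.count_cons, Finset.sum_add_distrib, Finset.sum_ite_eq', Finset.mem_Icc]
      congr 1
      exact if_congr ⟨fun h => h.2, fun h => ⟨ha, h⟩⟩ rfl rfl
    rw [Multiset.map_cons, Multiset.prod_cons, Multiset.map_cons, Multiset.prod_cons,
      ih fun i hi => hs i (Multiset.mem_cons_of_mem hi), hsum, markWeight, pow_add]
    push_cast
    split_ifs
    · ring
    · ring

lemma normConst_eq_expCoeff (θ : ℕ → ℝ) (n : ℕ) : normConst θ n = expCoeff θ n :=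
  sum_perm_eq_expCoeff θ n

lemma weight_nonneg {θ : ℕ → ℝ} (hθ : ∀ m : ℕ, 1 ≤ m → 0 ≤ θ m) {n : ℕ}
    (σ : Equiv.Perm (Fin n)) : 0 ≤ weight θ σ := by
  refine Multiset.prod_nonneg fun a ha => ?_
  obtain ⟨m, hm, rfl⟩ := Multiset.mem_map.1 ha
  exact hθ m (σ.partition.parts_pos hm)

lemma isProbabilityMeasure_weightedMeasure {θ : ℕ → ℝ} (hθ : ∀ m : ℕ, 1 ≤ m → 0 ≤ θ m) {n : ℕ}
    (hn : 0 < normConst θ n) : IsProbabilityMeasure (weightedMeasure θ n) := by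
  constructor
  have hf : (0 : ℝ) < (n ! : ℝ) := by exact_mod_cast Nat.factorial_pos n
  rw [weightedMeasure, Measure.coe_finsetSum, Finset.sum_apply]
  simp only [Measure.smul_apply, measure_univ, smul_eq_mul, mul_one]
  rw [← ENNReal.ofReal_sum_of_nonneg fun σ _ =>
    mul_nonneg (by positivity) (weight_nonneg hθ σ), ← Finset.mul_sum]
  have h : ∑ σ : Equiv.Perm (Fin n), weight θ σ = normConst θ n * (n ! : ℝ) := by
    rw [normConst]
    field_simp
  rw [h, one_div_mul_cancel (by positivity), ENNReal.ofReal_one]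

lemma charFun_map_normalizedCycles {θ : ℕ → ℝ} (hθ : ∀ m : ℕ, 1 ≤ m → 0 ≤ θ m) {ϑ : ℝ}
    (hϑ : 0 < ϑ) {n : ℕ} (hn : 0 < normConst θ n) (x t : ℝ) :
    charFun ((weightedMeasure θ n).map (normalizedCycles ϑ n x)) t =
      expCoeff (markWeight θ (Complex.exp ((t / √(ϑ * Real.log n) : ℝ) * Complex.I))
        ⌊(n : ℝ) ^ x⌋₊) n / ((expCoeff θ n : ℝ) : ℂ) *
      Complex.exp (-(Complex.I * t * x * √(ϑ * Real.log n))) := by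
  have hf : (0 : ℝ) < (n ! : ℝ) := by exact_mod_cast Nat.factorial_pos n
  have hf' : (n ! : ℂ) ≠ 0 := by exact_mod_cast hf.ne'
  have hn' : ((normConst θ n : ℝ) : ℂ) ≠ 0 := by exact_mod_cast hn.ne'
  rw [charFun_apply_real, integral_map (measurable_of_finite _).aemeasurable
    (by fun_prop), weightedMeasure, integral_finsetSum_measure fun σ _ =>
      Integrable.smul_measure Integrable.of_finite ENNReal.ofReal_ne_top]
  rw [← normConst_eq_expCoeff, ← sum_perm_eq_expCoeff, Finset.mul_sum, Finset.sum_div,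
    Finset.sum_mul]
  refine Finset.sum_congr rfl fun σ _ => ?_
  rw [integral_smul_measure, integral_dirac, ENNReal.toReal_ofReal
    (mul_nonneg (by positivity) (weight_nonneg hθ σ)),
    prod_map_markWeight _ _ _ _ fun i hi => σ.partition.parts_pos hi,
    ← Complex.exp_nat_mul]
  have hexp : Complex.exp (t * (normalizedCycles ϑ n x σ : ℝ) * Complex.I) =
      Complex.exp ((∑ m ∈ Finset.Icc 1 ⌊(n : ℝ) ^ x⌋₊, σ.partition.parts.count m : ℕ) *
        ((t / √(ϑ * Real.log n) : ℝ) * Complex.I)) *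
      Complex.exp (-(Complex.I * t * x * √(ϑ * Real.log n))) := by
    rw [← Complex.exp_add]
    congr 1
    have hsq : ϑ * Real.log n / √(ϑ * Real.log n) = √(ϑ * Real.log n) := Real.div_sqrt
    have hN : normalizedCycles ϑ n x σ =
        ((∑ m ∈ Finset.Icc 1 ⌊(n : ℝ) ^ x⌋₊, σ.partition.parts.count m : ℕ) : ℝ) /
          √(ϑ * Real.log n) - x * √(ϑ * Real.log n) := by
      rw [normalizedCycles, sub_div, mul_assoc, mul_div_assoc, hsq]
      rfl
    rw [hN]
    push_cast
    ring
  rw [hexp, Complex.real_smul, weight]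
  push_cast
  field_simp

theorem tendsto_charFun_normalizedCycles {θ : ℕ → ℝ} (hθ : ∀ m : ℕ, 1 ≤ m → 0 ≤ θ m) {r ϑ C : ℝ}
    (hr : 0 < r) (hϑ : 0 < ϑ) (hθr : ∀ m : ℕ, 1 ≤ m → |θ m * r ^ m - ϑ| ≤ C / m)
    {x : ℝ} (hx : x ∈ Set.Icc (0 : ℝ) 1) (t : ℝ) :
    Tendsto (fun n : ℕ => charFun ((weightedMeasure θ n).map (normalizedCycles ϑ n x)) t) atTop
      (𝓝 (charFun (gaussianReal 0 x.toNNReal) t)) := by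
  set u : ℕ → ℂ := fun n => Complex.exp ((t / √(ϑ * Real.log n) : ℝ) * Complex.I) with hu
  have hsT : Tendsto (fun n : ℕ => √(ϑ * Real.log n)) atTop atTop := Real.tendsto_sqrt_atTop.comp
    ((Real.tendsto_log_atTop.comp tendsto_natCast_atTop_atTop).const_mul_atTop hϑ)
  have hu1 : Tendsto u atTop (𝓝 1) := by
    have h0 : Tendsto (fun n : ℕ => t / √(ϑ * Real.log n)) atTop (𝓝 0) :=
      tendsto_const_nhds.div_atTop hsT
    have hc : Continuous fun y : ℝ => Complex.exp ((y : ℂ) * Complex.I) := by fun_prop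
    have h := (hc.tendsto 0).comp h0
    simp only [Complex.ofReal_zero, zero_mul, Complex.exp_zero] at h
    exact h
  have h1 := tendsto_expCoeff_markWeight_div_expCoeff_sub hϑ hθr (u := u)
    (fun n => (Complex.norm_exp_ofReal_mul_I _).le) hu1
    -- The minimum matters only at `n = 0`, where `0 ^ 0 = 1` breaks `⌊n^x⌋ ≤ n` if `x = 0`.
    (b := fun n => min ⌊(n : ℝ) ^ x⌋₊ n) (fun n => min_le_right _ _)
  have h2 := tendsto_prod_ewens_mul_exp hϑ hx.1 t
  set e : ℕ → ℂ := fun n => Complex.exp (-(Complex.I * t * x * √(ϑ * Real.log n))) with he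
  have hen : ∀ n, ‖e n‖ = 1 := fun n => by
    have : -(Complex.I * t * x * √(ϑ * Real.log n)) =
      ((-(t * x * √(ϑ * Real.log n)) : ℝ) : ℂ) * Complex.I := by push_cast; ring
    rw [he]
    simp only
    rw [this, Complex.norm_exp_ofReal_mul_I]
  have h3 := h1.norm
  rw [norm_zero] at h3
  have h4 : Tendsto (fun n => (expCoeff (markWeight (fun m => θ m * r ^ m) (u n)
      (min ⌊(n : ℝ) ^ x⌋₊ n)) n / ((expCoeff (fun m => θ m * r ^ m) n : ℝ) : ℂ) -
      ∏ j ∈ Finset.range (min ⌊(n : ℝ) ^ x⌋₊ n), (1 + ϑ * (u n - 1) / (ϑ + j))) * e n)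
      atTop (𝓝 0) := by
    rw [tendsto_zero_iff_norm_tendsto_zero]
    refine h3.congr fun n => ?_
    rw [norm_mul, hen, mul_one]
  have h5 := h4.add h2
  rw [charFun_gaussianReal, Real.coe_toNNReal x hx.1]
  have hlim : (0 : ℂ) + Complex.exp (-(x * (t : ℂ) ^ 2 / 2)) =
      Complex.exp (t * (0 : ℝ) * Complex.I - x * t ^ 2 / 2) := by
    rw [zero_add]
    congr 1
    push_cast
    ring
  rw [hlim] at h5
  refine h5.congr' ?_
  filter_upwards [eventually_expCoeff_pos hϑ (θ := fun m => θ m * r ^ m)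
    (fun m hm => mul_nonneg (hθ m hm) (pow_pos hr m).le) hθr, eventually_ge_atTop 1] with n hn hn1
  have hrn : (0 : ℝ) < r ^ n := pow_pos hr n
  have hscale := expCoeff_mul_pow θ r n
  have hpos : 0 < normConst θ n := by
    rw [normConst_eq_expCoeff]
    rw [hscale] at hn
    exact pos_of_mul_pos_right hn hrn.le
  have hmin : min ⌊(n : ℝ) ^ x⌋₊ n = ⌊(n : ℝ) ^ x⌋₊ := by
    refine min_eq_left (Nat.floor_le_of_le ?_)
    calc (n : ℝ) ^ x ≤ (n : ℝ) ^ (1 : ℝ) :=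
          Real.rpow_le_rpow_of_exponent_le (by exact_mod_cast hn1) hx.2
      _ = n := Real.rpow_one _
  -- Marking commutes with the rescaling by `r^m`, so the factor `r^n` cancels between numerator and
  -- denominator.
  have hmark : markWeight (fun m => θ m * r ^ m) (u n) ⌊(n : ℝ) ^ x⌋₊ =
      fun m => markWeight θ (u n) ⌊(n : ℝ) ^ x⌋₊ m * (r : ℂ) ^ m := by
    funext m
    simp only [markWeight]
    push_cast
    ring
  rw [charFun_map_normalizedCycles hθ hϑ hpos, hmin, hmark, expCoeff_mul_pow, hscale]
  have hrn' : (r : ℂ) ^ n ≠ 0 := by exact_mod_cast hrn.ne'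
  push_cast
  rw [mul_div_mul_left _ _ hrn', sub_mul]
  simp only [hu, he]
  push_cast
  ring

theorem exists_tendstoInDistribution_normalizedCycles {θ : ℕ → ℝ}
    (hθ : ∀ m : ℕ, 1 ≤ m → 0 ≤ θ m) {r ϑ C : ℝ}
    (hr : 0 < r) (hϑ : 0 < ϑ) (hθr : ∀ m : ℕ, 1 ≤ m → |θ m * r ^ m - ϑ| ≤ C / m)
    {x : ℝ} (hx : x ∈ Set.Icc (0 : ℝ) 1) :
    ∃ N : ℕ, ∃ _ : ∀ n : ℕ, IsProbabilityMeasure (weightedMeasure θ (N + n)),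
      TendstoInDistribution
        (fun (n : ℕ) (σ : Equiv.Perm (Fin (N + n))) => normalizedCycles ϑ (N + n) x σ)
        atTop (fun y : ℝ => y) (fun n : ℕ => weightedMeasure θ (N + n))
        (gaussianReal 0 x.toNNReal) := by
  obtain ⟨N, hN⟩ := eventually_atTop.1 (eventually_expCoeff_pos hϑ (θ := fun m => θ m * r ^ m)
    (fun m hm => mul_nonneg (hθ m hm) (pow_pos hr m).le) hθr)
  have hprob : ∀ n : ℕ, IsProbabilityMeasure (weightedMeasure θ (N + n)) := fun n => by
    refine isProbabilityMeasure_weightedMeasure hθ ?_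
    have h := hN (N + n) (Nat.le_add_right N n)
    rw [expCoeff_mul_pow] at h
    rw [normConst_eq_expCoeff]
    exact pos_of_mul_pos_right h (pow_pos hr _).le
  refine ⟨N, hprob, ⟨fun n => (measurable_of_finite _).aemeasurable, by fun_prop, ?_⟩⟩
  refine ProbabilityMeasure.tendsto_iff_tendsto_charFun.2 fun t => ?_
  simp only [ProbabilityMeasure.coe_mk]
  rw [Measure.map_id']
  exact (tendsto_charFun_normalizedCycles hθ hr hϑ hθr hx t).comp
    (tendsto_atTop_mono (fun n => Nat.le_add_left n N) tendsto_id)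

/-! ### Taylor coefficients from a bound on the third derivative. -/

lemma iteratedDeriv_zero_eq_of_hasSum {H : ℂ → ℂ} {h : ℕ → ℂ}
    (hpow : ∀ᶠ t in 𝓝 (0 : ℂ), HasSum (fun n => h n * t ^ n) (H t)) (n : ℕ) :
    iteratedDeriv n H 0 = n ! * h n := by
  have h1 : HasFPowerSeriesAt H (FormalMultilinearSeries.ofScalars ℂ h) 0 := by
    rw [hasFPowerSeriesAt_iff]
    filter_upwards [hpow] with t ht
    simpa [FormalMultilinearSeries.coeff_ofScalars, mul_comm] using ht
  have h2 := h1.analyticAt.hasFPowerSeriesAt.eq_formalMultilinearSeries h1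
  have h3 := congrArg (fun p => FormalMultilinearSeries.coeff p n) h2
  simp only [FormalMultilinearSeries.coeff_ofScalars] at h3
  rw [← h3, mul_div_cancel₀ _ (Nat.cast_ne_zero.2 (Nat.factorial_ne_zero n))]

lemma differentiableOn_iteratedDeriv {H : ℂ → ℂ} {s : Set ℂ} (hs : IsOpen s)
    (hH : DifferentiableOn ℂ H s) (n : ℕ) : DifferentiableOn ℂ (iteratedDeriv n H) s := by
  induction n with
  | zero => simpa using hH
  | succ n ih =>
    rw [iteratedDeriv_succ]
    exact ih.deriv hs

/-- The Poisson kernel of the circle of radius `r` at the point `ρ` has mean `1`, and `|r e^{ia} -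
ρ| = |ρ e^{ia} - r|`. -/
lemma integral_one_div_norm_circleMap_sub_sq {r ρ : ℝ} (hρ : 0 < ρ) (hρr : ρ < r) :
    (2 * Real.pi)⁻¹ * ∫ a in (0 : ℝ)..2 * Real.pi, 1 / ‖circleMap 0 ρ a - (r : ℂ)‖ ^ 2 =
      1 / (r ^ 2 - ρ ^ 2) := by
  have hw : (ρ : ℂ) ∈ Metric.ball (0 : ℂ) r := by
    simpa [abs_of_pos hρ] using hρr
  have hd : r ^ 2 - ρ ^ 2 ≠ 0 := by nlinarith
  have h := DiffContOnCl.circleAverage_poissonKernel_smul' (f := fun _ : ℂ => (1 : ℂ))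
    (c := 0) (R := r) (w := (ρ : ℂ)) diffContOnCl_const hw
  have hnorm : ∀ a : ℝ, ‖circleMap 0 r a - (ρ : ℂ)‖ = ‖circleMap 0 ρ a - (r : ℂ)‖ := by
    intro a
    rw [← sq_eq_sq₀ (norm_nonneg _) (norm_nonneg _), ← Complex.normSq_eq_norm_sq,
      ← Complex.normSq_eq_norm_sq, Complex.normSq_apply, Complex.normSq_apply]
    simp only [circleMap, Complex.exp_mul_I, sub_zero, zero_add, Complex.sub_re, Complex.sub_im,
      Complex.mul_re, Complex.mul_im, Complex.add_re, Complex.add_im, Complex.ofReal_re,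
      Complex.ofReal_im, Complex.I_re, Complex.I_im, Complex.cos_ofReal_re, Complex.cos_ofReal_im,
      Complex.sin_ofReal_re, Complex.sin_ofReal_im]
    linear_combination (r ^ 2 - ρ ^ 2) * Real.sin_sq_add_cos_sq a
  rw [Real.circleAverage_def] at h
  simp only [hnorm, sub_zero, norm_circleMap_zero, Complex.norm_real, Real.norm_eq_abs, sq_abs,
    Complex.real_smul, mul_one, intervalIntegral.integral_ofReal] at h
  have h' : (2 * Real.pi)⁻¹ * ∫ a in (0 : ℝ)..2 * Real.pi,
      (r ^ 2 - ρ ^ 2) / ‖circleMap 0 ρ a - (r : ℂ)‖ ^ 2 = 1 := by exact_mod_cast h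
  simp only [div_eq_mul_one_div (r ^ 2 - ρ ^ 2), intervalIntegral.integral_const_mul] at h'
  rw [eq_div_iff hd]
  linarith

/-- On a circle with `r - ρ` of order `r/m`, the mean of `|t - r|⁻²` is only of order `m`, whereas
three derivatives multiply the coefficient by about `m³`. Two derivatives would leave the mean of
`|t - r|⁻¹`, which costs a logarithm. -/
theorem coeff_bound_of_iteratedDeriv_three {H : ℂ → ℂ} {h : ℕ → ℂ} {r C : ℝ} (hr : 0 < r)
    (hH : DifferentiableOn ℂ H (Metric.ball 0 r))
    (hpow : ∀ᶠ t in 𝓝 (0 : ℂ), HasSum (fun n => h n * t ^ n) (H t))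
    (hb : ∀ t : ℂ, ‖t‖ < r → ‖iteratedDeriv 3 H t‖ ≤ C / ‖t - r‖ ^ 2) (m : ℕ) :
    ((m : ℝ) + 3) * ‖h (m + 3)‖ * r ^ (m + 3) ≤ Real.exp 1 * C * r / (m + 1) := by
  have hC : 0 ≤ C := by
    have h0 := (norm_nonneg _).trans (hb 0 (by simpa using hr))
    rwa [zero_sub, norm_neg, Complex.norm_real, Real.norm_of_nonneg hr.le,
      le_div_iff₀ (by positivity), zero_mul] at h0
  set ρ : ℝ := r * ((m + 1) / (m + 2)) with hρdef
  have hm1 : (0 : ℝ) < (m : ℝ) + 1 := by positivity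
  have hm2 : (0 : ℝ) < (m : ℝ) + 2 := by positivity
  have hρ : 0 < ρ := by positivity
  have hρsub : r - ρ = r / (m + 2) := by rw [hρdef]; field_simp; ring
  have hρr : ρ < r := by
    have : 0 < r / ((m : ℝ) + 2) := by positivity
    linarith
  set F := iteratedDeriv 3 H with hF
  have hFd : DifferentiableOn ℂ F (Metric.ball 0 r) :=
    differentiableOn_iteratedDeriv Metric.isOpen_ball hH 3
  have hFd' : DifferentiableOn ℂ F (Metric.closedBall 0 ρ) :=
    hFd.mono (Metric.closedBall_subset_ball hρr)
  have hps : HasFPowerSeriesOnBall F (cauchyPowerSeries F 0 ρ) 0 (ENNReal.ofReal ρ) := by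
    have := DifferentiableOn.hasFPowerSeriesOnBall (R := ρ.toNNReal) (c := 0) (f := F)
      (by rwa [Real.coe_toNNReal _ hρ.le]) (by simpa using hρ)
    rwa [Real.coe_toNNReal _ hρ.le] at this
  have hcoef := hps.hasFPowerSeriesAt.eq_formalMultilinearSeries
    hps.hasFPowerSeriesAt.analyticAt.hasFPowerSeriesAt
  have hnormcoef : ‖cauchyPowerSeries F 0 ρ m‖ = ‖iteratedDeriv m F 0 / ((m ! : ℕ) : ℂ)‖ := by
    rw [FormalMultilinearSeries.norm_apply_eq_norm_coef, hcoef,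
      FormalMultilinearSeries.coeff_ofScalars]
  have hiter : iteratedDeriv m F 0 = ((m + 3) ! : ℕ) * h (m + 3) := by
    rw [← iteratedDeriv_zero_eq_of_hasSum hpow, hF, iteratedDeriv_eq_iterate,
      iteratedDeriv_eq_iterate, iteratedDeriv_eq_iterate, Function.iterate_add_apply]
  have hle := norm_cauchyPowerSeries_le F 0 ρ m
  have hmem : ∀ a : ℝ, ‖circleMap 0 ρ a‖ < r := fun a => by
    rw [norm_circleMap_zero, abs_of_pos hρ]
    exact hρr
  have hne : ∀ a : ℝ, ‖circleMap 0 ρ a - (r : ℂ)‖ ^ 2 ≠ 0 := by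
    intro a h0
    have h1 : circleMap 0 ρ a = r :=
      sub_eq_zero.1 (norm_eq_zero.1 (pow_eq_zero_iff two_ne_zero |>.1 h0))
    have h2 := hmem a
    rw [h1, Complex.norm_real, Real.norm_of_nonneg hr.le] at h2
    exact lt_irrefl _ h2
  have hint : ∫ a in (0 : ℝ)..2 * Real.pi, ‖F (circleMap 0 ρ a)‖ ≤
      ∫ a in (0 : ℝ)..2 * Real.pi, C * (1 / ‖circleMap 0 ρ a - (r : ℂ)‖ ^ 2) := by
    refine intervalIntegral.integral_mono_on Real.two_pi_pos.le ?_ ?_ fun a _ => ?_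
    · refine Continuous.intervalIntegrable ?_ _ _
      refine continuous_norm.comp (hFd.continuousOn.comp_continuous (continuous_circleMap 0 ρ) ?_)
      intro a
      simpa using hmem a
    · refine Continuous.intervalIntegrable ?_ _ _
      exact continuous_const.mul (continuous_const.div
        (((continuous_circleMap 0 ρ).sub continuous_const).norm.pow 2) hne)
    · refine (hb _ (hmem a)).trans (le_of_eq ?_)
      rw [mul_one_div]
  have hmain : ‖cauchyPowerSeries F 0 ρ m‖ ≤ C * (1 / (r ^ 2 - ρ ^ 2)) * ρ⁻¹ ^ m := by
    refine hle.trans ?_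
    rw [abs_of_pos hρ, ← integral_one_div_norm_circleMap_sub_sq hρ hρr]
    rw [intervalIntegral.integral_const_mul] at hint
    have hpi := Real.pi_pos
    calc _ ≤ ((2 * Real.pi)⁻¹ * (C * ∫ a in (0 : ℝ)..2 * Real.pi,
          1 / ‖circleMap 0 ρ a - (r : ℂ)‖ ^ 2)) * ρ⁻¹ ^ m := by gcongr
      _ = _ := by ring
  rw [hnormcoef, hiter] at hmain
  have hfac : (((m + 3) ! : ℕ) : ℂ) * h (m + 3) / (m ! : ℕ) =
      (((m : ℝ) + 1) * (m + 2) * (m + 3) : ℝ) * h (m + 3) := by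
    have : ((m ! : ℕ) : ℂ) ≠ 0 := by exact_mod_cast Nat.factorial_ne_zero m
    rw [Nat.factorial_succ, Nat.factorial_succ, Nat.factorial_succ]
    push_cast
    field_simp
    ring
  rw [hfac, norm_mul, Complex.norm_real, Real.norm_of_nonneg (by positivity)] at hmain
  have hsq : 1 / (r ^ 2 - ρ ^ 2) ≤ (m + 2) / r ^ 2 := by
    have h1 : r ^ 2 - ρ ^ 2 = r / (m + 2) * (r + ρ) := by rw [← hρsub]; ring
    rw [h1, div_le_div_iff₀ (by positivity) (by positivity)]
    have h2 : (m + 2) * (r / ((m : ℝ) + 2) * (r + ρ)) = r * (r + ρ) := by field_simp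
    rw [h2]
    nlinarith
  -- The choice of `ρ` makes `r/ρ = 1 + 1/(m+1)`, so its `m`-th power stays below `e`.
  have hpow' : ρ⁻¹ ^ m * r ^ m ≤ Real.exp 1 := by
    have h1 : ρ⁻¹ * r = 1 + (((m + 1 : ℕ) : ℝ))⁻¹ := by
      rw [hρdef]
      push_cast
      field_simp
      ring
    rw [← mul_pow, h1]
    calc (1 + (((m + 1 : ℕ) : ℝ))⁻¹) ^ m ≤ (1 + (((m + 1 : ℕ) : ℝ))⁻¹) ^ (m + 1) := by
          refine pow_le_pow_right₀ ?_ (Nat.le_succ m)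
          have : (0 : ℝ) ≤ (((m + 1 : ℕ) : ℝ))⁻¹ := by positivity
          linarith
      _ ≤ Real.exp 1 := Real.one_add_inv_pow_le_exp
  have hfin : (((m : ℝ) + 1) * (m + 2)) * (((m : ℝ) + 3) * ‖h (m + 3)‖ * r ^ (m + 3)) ≤
      (((m : ℝ) + 1) * (m + 2)) * (Real.exp 1 * C * r / (m + 1)) := by
    calc (((m : ℝ) + 1) * (m + 2)) * (((m : ℝ) + 3) * ‖h (m + 3)‖ * r ^ (m + 3))
        = (((m : ℝ) + 1) * (m + 2) * (m + 3) * ‖h (m + 3)‖) * r ^ (m + 3) := by ring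
      _ ≤ (C * (1 / (r ^ 2 - ρ ^ 2)) * ρ⁻¹ ^ m) * r ^ (m + 3) := by gcongr
      _ ≤ (C * ((m + 2) / r ^ 2) * ρ⁻¹ ^ m) * r ^ (m + 3) := by gcongr
      _ = C * (m + 2) * r * (ρ⁻¹ ^ m * r ^ m) := by field_simp; ring
      _ ≤ C * (m + 2) * r * Real.exp 1 := by gcongr
      _ = _ := by field_simp
  exact le_of_mul_le_mul_left hfin (by positivity)

/-! ### Geometry of the domain and the estimate `θ_m r^m = ϑ + O(1/m)`. -/

lemma mem_delta0_iff {r R α : ℝ} (hα : 0 < α) (hα' : α < Real.pi / 2) {z : ℂ} :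
    z ∈ delta0 r R α ↔ ‖z‖ < R ∧ (z - r).re < ‖z - r‖ * Real.cos α := by
  have hpi := Real.pi_pos
  have key : z ≠ r → (α < |Complex.arg (z - r)| ↔ (z - r).re < ‖z - r‖ * Real.cos α) := by
    intro hz
    have hz' : z - r ≠ 0 := sub_ne_zero.2 hz
    rw [← Real.strictAntiOn_cos.lt_iff_gt ⟨abs_nonneg _, Complex.abs_arg_le_pi _⟩
      ⟨hα.le, by linarith⟩, Real.cos_abs, Complex.cos_arg hz',
      div_lt_iff₀ (norm_pos_iff.2 hz'), mul_comm]
  constructor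
  · rintro ⟨h1, h2, h3⟩
    exact ⟨h1, (key h2).1 h3⟩
  · rintro ⟨h1, h2⟩
    have hz : z ≠ r := by
      rintro rfl
      simp at h2
    exact ⟨h1, hz, (key hz).2 h2⟩

/-- The disc `‖t‖ ≤ r` lies in the half-plane `re (t - r) ≤ 0`, away from the excluded sector, so
`t` has room proportional to `‖t - r‖`. The term `cos α / 4` keeps `t + w` out of the sector; the
other, with `‖t - r‖ ≤ 2r`, keeps its modulus below `R`. -/
lemma add_mem_delta0 {r R α : ℝ} (hr : 0 < r) (hR : r < R) (hα : 0 < α) (hα' : α < Real.pi / 2)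
    {t w : ℂ} (ht : ‖t‖ ≤ r) (htr : t ≠ r)
    (hw : ‖w‖ ≤ min (Real.cos α / 4) ((R - r) / (4 * r)) * ‖t - r‖) :
    t + w ∈ delta0 r R α := by
  have hcos : 0 < Real.cos α := Real.cos_pos_of_mem_Ioo ⟨by linarith, hα'⟩
  have hcos1 := Real.cos_le_one α
  have hv : 0 < ‖t - r‖ := norm_pos_iff.2 (sub_ne_zero.2 htr)
  have hw1 : ‖w‖ ≤ Real.cos α / 4 * ‖t - r‖ :=
    hw.trans (mul_le_mul_of_nonneg_right (min_le_left _ _) hv.le)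
  have hw2 : ‖w‖ ≤ (R - r) / (4 * r) * ‖t - r‖ :=
    hw.trans (mul_le_mul_of_nonneg_right (min_le_right _ _) hv.le)
  have hvr : ‖t - r‖ ≤ 2 * r := by
    refine (norm_sub_le _ _).trans ?_
    rw [Complex.norm_real, Real.norm_of_nonneg hr.le]
    linarith
  rw [mem_delta0_iff hα hα']
  constructor
  · have h1 : (R - r) / (4 * r) * ‖t - r‖ ≤ (R - r) / (4 * r) * (2 * r) :=
      mul_le_mul_of_nonneg_left hvr (div_nonneg (by linarith) (by linarith))
    have h2 : (R - r) / (4 * r) * (2 * r) = (R - r) / 2 := by field_simp; norm_num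
    have := norm_add_le t w
    linarith
  · have hre : (t - r).re ≤ 0 := by
      have h1 : ‖t‖ ^ 2 ≤ r ^ 2 := by gcongr
      rw [← Complex.normSq_eq_norm_sq, Complex.normSq_apply] at h1
      simp only [Complex.sub_re, Complex.ofReal_re]
      nlinarith [mul_self_nonneg t.im, mul_self_nonneg t.re]
    have h2 : (t + w - r).re ≤ ‖w‖ := by
      have := Complex.re_le_norm w
      have : (t + w - r).re = (t - r).re + w.re := by
        simp only [Complex.sub_re, Complex.add_re]; ring
      linarith
    have h3 : ‖t - r‖ - ‖w‖ ≤ ‖t + w - r‖ := by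
      have := norm_sub_norm_le (t - r) (-w)
      rw [norm_neg] at this
      rwa [show t + w - (r : ℂ) = t - r - -w by ring]
    have h4 : (3 / 4 * ‖t - r‖) * Real.cos α ≤ ‖t + w - r‖ * Real.cos α := by
      refine mul_le_mul_of_nonneg_right ?_ hcos.le
      nlinarith
    nlinarith [mul_pos hcos hv]

lemma one_sub_div_mem_slitPlane {r R α : ℝ} (hr : 0 < r) (hα : 0 < α) (hα' : α < Real.pi / 2)
    {t : ℂ} (ht : t ∈ delta0 r R α) : 1 - t / (r : ℂ) ∈ Complex.slitPlane := by
  obtain ⟨-, h⟩ := (mem_delta0_iff hα hα').1 ht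
  rw [Complex.mem_slitPlane_iff]
  by_contra! hcon
  obtain ⟨h1, h2⟩ := hcon
  simp only [Complex.sub_re, Complex.one_re, Complex.div_ofReal_re, Complex.sub_im,
    Complex.one_im, Complex.div_ofReal_im, zero_sub, neg_eq_zero, div_eq_zero_iff] at h1 h2
  have him : t.im = 0 := h2.resolve_right hr.ne'
  have hre : 0 ≤ t.re - r := by
    have : 1 ≤ t.re / r := by linarith
    rw [le_div_iff₀ hr] at this
    linarith
  have ht' : t - r = ((t.re - r : ℝ) : ℂ) := by
    apply Complex.ext <;> simp [him]
  rw [ht', Complex.ofReal_re, Complex.norm_real, Real.norm_of_nonneg hre] at h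
  nlinarith [Real.cos_le_one α]

lemma exists_norm_le_mul_of_isBigO {r R α : ℝ} (hr : 0 < r) (hR : r < R) (hα : 0 < α)
    (hα' : α < Real.pi / 2) {H : ℂ → ℂ} (hH : DifferentiableOn ℂ H (delta0 r R α))
    (hO : H =O[𝓝[delta0 r R α] (r : ℂ)] (fun t : ℂ => t - (r : ℂ))) :
    ∃ M : ℝ, ∀ t : ℂ, ‖t‖ ≤ r → t ≠ r → ∀ w : ℂ,
      ‖w‖ ≤ min (Real.cos α / 4) ((R - r) / (4 * r)) * ‖t - r‖ → ‖H (t + w)‖ ≤ M * ‖t - r‖ := by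
  set c := min (Real.cos α / 4) ((R - r) / (4 * r)) with hc
  have hcos1 := Real.cos_le_one α
  have hc1 : c ≤ 1 := (min_le_left _ _).trans (by linarith)
  obtain ⟨A, hA, hO⟩ := hO.exists_pos
  obtain ⟨d, hd, hO⟩ := Metric.eventually_nhds_iff.1 (eventually_nhdsWithin_iff.1 hO.bound)
  -- Away from `r` the admissible pairs `(t, w)` form a compact set, on which continuity bounds `H
  -- (t + w)`; near `r` the `O(t - r)` hypothesis is used instead.
  set S : Set (ℂ × ℂ) := {p | ‖p.1‖ ≤ r ∧ d / 2 ≤ ‖p.1 - r‖ ∧ ‖p.2‖ ≤ c * ‖p.1 - r‖} with hS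
  have hScl : IsClosed S := by
    have h1 : IsClosed {p : ℂ × ℂ | ‖p.1‖ ≤ r} := isClosed_le (by fun_prop) (by fun_prop)
    have h2 : IsClosed {p : ℂ × ℂ | d / 2 ≤ ‖p.1 - r‖} := isClosed_le (by fun_prop) (by fun_prop)
    have h3 : IsClosed {p : ℂ × ℂ | ‖p.2‖ ≤ c * ‖p.1 - r‖} :=
      isClosed_le (by fun_prop) (by fun_prop)
    exact h1.inter (h2.inter h3)
  have hSc : IsCompact S := by
    refine ((isCompact_closedBall (0 : ℂ) r).prod (isCompact_closedBall (0 : ℂ)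
      (2 * r))).of_isClosed_subset hScl fun p hp => ?_
    obtain ⟨h1, -, h3⟩ := hp
    have hvr : ‖p.1 - r‖ ≤ 2 * r := by
      refine (norm_sub_le _ _).trans ?_
      rw [Complex.norm_real, Real.norm_of_nonneg hr.le]
      linarith
    refine ⟨by simpa using h1, ?_⟩
    have : ‖p.2‖ ≤ 1 * ‖p.1 - r‖ := h3.trans (mul_le_mul_of_nonneg_right hc1 (norm_nonneg _))
    simp only [Metric.mem_closedBall, dist_zero_right]
    linarith
  have hcont : ContinuousOn (fun p : ℂ × ℂ => H (p.1 + p.2)) S := by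
    refine hH.continuousOn.comp (by fun_prop) fun p hp => ?_
    obtain ⟨h1, h2, h3⟩ := hp
    refine add_mem_delta0 hr hR hα hα' h1 (fun h => ?_) h3
    rw [h, sub_self, norm_zero] at h2
    linarith
  obtain ⟨B, hB⟩ := hSc.exists_bound_of_continuousOn hcont
  refine ⟨2 * A + |B| * (2 / d), fun t ht htr w hw => ?_⟩
  have hv : 0 < ‖t - r‖ := norm_pos_iff.2 (sub_ne_zero.2 htr)
  rcases lt_or_ge ‖t - r‖ (d / 2) with hlt | hge
  · have hw1 : ‖w‖ ≤ 1 * ‖t - r‖ := hw.trans (mul_le_mul_of_nonneg_right hc1 hv.le)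
    have h1 : ‖t + w - r‖ ≤ 2 * ‖t - r‖ := by
      have := norm_add_le (t - r) w
      rw [show t + w - (r : ℂ) = t - r + w by ring]
      linarith
    have h2 := hO (y := t + w) (by rw [dist_eq_norm]; linarith)
      (add_mem_delta0 hr hR hα hα' ht htr hw)
    calc ‖H (t + w)‖ ≤ A * ‖t + w - r‖ := h2
      _ ≤ A * (2 * ‖t - r‖) := by gcongr
      _ = 2 * A * ‖t - r‖ := by ring
      _ ≤ (2 * A + |B| * (2 / d)) * ‖t - r‖ := by
        gcongr
        have : 0 ≤ |B| * (2 / d) := by positivity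
        linarith
  · have h1 := hB (t, w) ⟨ht, hge, hw⟩
    have h2 : 1 ≤ 2 / d * ‖t - r‖ := by
      rw [div_mul_eq_mul_div, le_div_iff₀ hd]
      linarith
    calc ‖H (t + w)‖ ≤ |B| * 1 := by rw [mul_one]; exact h1.trans (le_abs_self B)
      _ ≤ |B| * (2 / d * ‖t - r‖) := by gcongr
      _ = (|B| * (2 / d)) * ‖t - r‖ := by ring
      _ ≤ _ := by gcongr; linarith

/-- Cauchy's estimate on the disc about `t` of radius `c ‖t - r‖`, where `H = O(‖t - r‖)`; three
derivatives divide by the cube of the radius. -/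
lemma exists_norm_iteratedDeriv_three_le {r R α : ℝ} (hr : 0 < r) (hR : r < R) (hα : 0 < α)
    (hα' : α < Real.pi / 2) {H : ℂ → ℂ} (hH : DifferentiableOn ℂ H (delta0 r R α))
    (hO : H =O[𝓝[delta0 r R α] (r : ℂ)] (fun t : ℂ => t - (r : ℂ))) :
    ∃ C : ℝ, ∀ t : ℂ, ‖t‖ < r → ‖iteratedDeriv 3 H t‖ ≤ C / ‖t - r‖ ^ 2 := by
  obtain ⟨M, hM⟩ := exists_norm_le_mul_of_isBigO hr hR hα hα' hH hO
  set c := min (Real.cos α / 4) ((R - r) / (4 * r)) with hc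
  have hcos : 0 < Real.cos α := Real.cos_pos_of_mem_Ioo ⟨by linarith, hα'⟩
  have hc0 : 0 < c := lt_min (by linarith) (div_pos (by linarith) (by linarith))
  refine ⟨(3 ! : ℕ) * M / c ^ 3, fun t ht => ?_⟩
  have htr : t ≠ r := by
    rintro rfl
    rw [Complex.norm_real, Real.norm_of_nonneg hr.le] at ht
    exact lt_irrefl _ ht
  have hv : 0 < ‖t - r‖ := norm_pos_iff.2 (sub_ne_zero.2 htr)
  have hsub : Metric.closedBall t (c * ‖t - r‖) ⊆ delta0 r R α := fun z hz => by
    rw [mem_closedBall_iff_norm] at hz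
    have := add_mem_delta0 hr hR hα hα' ht.le htr hz
    rwa [add_sub_cancel] at this
  have h := Complex.norm_iteratedDeriv_le_of_forall_mem_sphere_norm_le 3
    (mul_pos hc0 hv) ((hH.mono (Metric.closure_ball_subset_closedBall.trans hsub)).diffContOnCl)
    (C := M * ‖t - r‖) fun z hz => by
      rw [mem_sphere_iff_norm] at hz
      have := hM t ht.le htr (z - t) hz.le
      rwa [add_sub_cancel] at this
  refine h.trans (le_of_eq ?_)
  field_simp

theorem exists_abs_mul_pow_sub_le {θ : ℕ → ℝ} {r ϑ K : ℝ} (hr : 0 < r)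
    (hg : GenFunInF θ r ϑ K) :
    ∃ C : ℝ, ∀ m : ℕ, 1 ≤ m → |θ m * r ^ m - ϑ| ≤ C / m := by
  obtain ⟨G, ⟨R, α, hR, hα, hα', hG, hO⟩, hsum⟩ := hg
  have hrc : (r : ℂ) ≠ 0 := by exact_mod_cast hr.ne'
  have hlog : ∀ t ∈ delta0 r R α,
      Complex.log (1 / (1 - t / (r : ℂ))) = -Complex.log (1 - t / (r : ℂ)) := fun t ht => by
    rw [one_div, Complex.log_inv _
      (Complex.slitPlane_arg_ne_pi (one_sub_div_mem_slitPlane hr hα hα' ht))]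
  set H : ℂ → ℂ := fun t => G t - ((ϑ : ℂ) * Complex.log (1 / (1 - t / (r : ℂ))) + (K : ℂ)) with hH
  have hHd : DifferentiableOn ℂ H (delta0 r R α) := by
    refine hG.sub (DifferentiableOn.add_const _ (DifferentiableOn.const_mul ?_ _))
    refine ((DifferentiableOn.clog (f := fun t : ℂ => 1 - t / (r : ℂ)) (by fun_prop)
      fun t ht => one_sub_div_mem_slitPlane hr hα hα' ht).neg).congr fun t ht => ?_
    exact hlog t ht
  obtain ⟨C, hC⟩ := exists_norm_iteratedDeriv_three_le hr hR hα hα' hHd hO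
  have hball : Metric.ball (0 : ℂ) r ⊆ delta0 r R α := fun t ht => by
    have ht' : ‖t‖ < r := by simpa using ht
    have htr : t ≠ r := by
      rintro rfl
      rw [Complex.norm_real, Real.norm_of_nonneg hr.le] at ht'
      exact lt_irrefl _ ht'
    have hcos : 0 < Real.cos α := Real.cos_pos_of_mem_Ioo ⟨by linarith, hα'⟩
    have := add_mem_delta0 hr hR hα hα' ht'.le htr (w := 0) (by
      rw [norm_zero]
      exact mul_nonneg (lt_min (by linarith) (div_pos (by linarith) (by linarith))).le
        (norm_nonneg _))
    rwa [add_zero] at this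
  -- At `n = 0` both quotients are `0` because division by zero gives `0`, so `h 0 = -K`.
  set h : ℕ → ℂ := fun n => (θ n : ℂ) / n - ((ϑ : ℂ) * ((1 / (r : ℂ) ^ n) / n) +
    if n = 0 then (K : ℂ) else 0) with hh
  have hpow : ∀ᶠ t in 𝓝 (0 : ℂ), HasSum (fun n => h n * t ^ n) (H t) := by
    filter_upwards [hsum, Metric.ball_mem_nhds (0 : ℂ) hr] with t ht htr
    have htr' : ‖t / (r : ℂ)‖ < 1 := by
      rw [norm_div, Complex.norm_real, Real.norm_of_nonneg hr.le, div_lt_one hr]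
      simpa using htr
    have h1 : HasSum (fun n : ℕ => (θ n : ℂ) / n * t ^ n) (G t) := by
      rw [← hasSum_nat_add_iff' 1]
      simpa using ht
    have h2 := Complex.hasSum_taylorSeries_neg_log htr'
    have h3 : HasSum (fun n : ℕ => if n = 0 then (K : ℂ) else 0) K := hasSum_ite_eq 0 (K : ℂ)
    have h4 := h1.sub ((h2.mul_left (ϑ : ℂ)).add h3)
    rw [← hlog t (hball htr)] at h4
    have hfun : (fun n => h n * t ^ n) = fun n : ℕ => (θ n : ℂ) / n * t ^ n -
        ((ϑ : ℂ) * ((t / (r : ℂ)) ^ n / n) + if n = 0 then (K : ℂ) else 0) := by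
      funext n
      simp only [hh, div_pow]
      split_ifs with hn
      · subst hn
        simp
      · ring
    rw [hfun]
    exact h4
  have hmain := coeff_bound_of_iteratedDeriv_three hr (hHd.mono hball) hpow hC
  have hnorm : ∀ m : ℕ, 1 ≤ m → (m : ℝ) * ‖h m‖ * r ^ m = |θ m * r ^ m - ϑ| := by
    intro m hm
    have hm0 : (m : ℂ) ≠ 0 := by exact_mod_cast (by omega : m ≠ 0)
    have heq : (m : ℂ) * h m * (r : ℂ) ^ m = ((θ m * r ^ m - ϑ : ℝ) : ℂ) := by
      simp only [hh]
      rw [if_neg (by omega)]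
      push_cast
      field_simp
      ring
    have h1 := congrArg norm heq
    rwa [norm_mul, norm_mul, Complex.norm_natCast, norm_pow, Complex.norm_real, Complex.norm_real,
      Real.norm_of_nonneg hr.le, Real.norm_eq_abs] at h1
  set B := Real.exp 1 * |C| * r with hB
  have hB0 : 0 ≤ B := by positivity
  -- The derivative bound reaches only `m = k + 3`, where `m ≤ 3(k + 1)` gives the factor `3`; the
  -- last two terms cover `m = 1` and `m = 2`.
  refine ⟨3 * B + |θ 1 * r ^ 1 - ϑ| + 2 * |θ 2 * r ^ 2 - ϑ|, fun m hm => ?_⟩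
  have ha1 := abs_nonneg (θ 1 * r ^ 1 - ϑ)
  have ha2 := abs_nonneg (θ 2 * r ^ 2 - ϑ)
  rw [le_div_iff₀ (by exact_mod_cast hm)]
  rcases (by omega : m = 1 ∨ m = 2 ∨ 3 ≤ m) with rfl | rfl | hm3
  · push_cast
    linarith
  · push_cast
    linarith
  · obtain ⟨k, rfl⟩ := Nat.exists_eq_add_of_le' hm3
    have h1 := hmain k
    have h2 := hnorm (k + 3) hm
    push_cast at h2 ⊢
    rw [h2] at h1
    have h3 : Real.exp 1 * C * r / (k + 1) ≤ B / (k + 1) := by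
      rw [hB]
      gcongr
      exact le_abs_self C
    have h4 := h1.trans h3
    rw [le_div_iff₀ (by positivity)] at h4
    have hk : (0 : ℝ) ≤ k := Nat.cast_nonneg k
    nlinarith [abs_nonneg (θ (k + 3) * r ^ (k + 3) - ϑ),
      mul_nonneg hk (abs_nonneg (θ (k + 3) * r ^ (k + 3) - ϑ))]

end WeightedPerm

theorem mainTheorem10
    (θ : ℕ → ℝ) (hθ : ∀ m : ℕ, 1 ≤ m → 0 ≤ θ m)
    (r ϑ K : ℝ) (hr : 0 < r) (hϑ : 0 < ϑ)
    (hg : WeightedPerm.GenFunInF θ r ϑ K)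
    (x : ℝ) (hx : x ∈ Set.Icc (0 : ℝ) 1) :
    ∃ N : ℕ, ∃ _ : ∀ n : ℕ, IsProbabilityMeasure (WeightedPerm.weightedMeasure θ (N + n)),
      TendstoInDistribution
        (fun (n : ℕ) (σ : Equiv.Perm (Fin (N + n))) =>
          WeightedPerm.normalizedCycles ϑ (N + n) x σ)
        atTop (fun y : ℝ => y)
        (fun n : ℕ => WeightedPerm.weightedMeasure θ (N + n))
        (gaussianReal 0 x.toNNReal) := by
  obtain ⟨C, hC⟩ := WeightedPerm.exists_abs_mul_pow_sub_le hr hg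
  exact WeightedPerm.exists_tendstoInDistribution_normalizedCycles hθ hr hϑ hC hx
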